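/- Let $d\ge 1$. For $h>0$ write $f_j=f(hj)$, $j\in\mathbb Z^d$, for functions $f$ on $(h\mathbb Z)^d$, and let $$\Delta_{\mathrm d} f_j=\frac1{h^2}\sum_{k=1}^d\big(f_{j+e_k}-2f_j+f_{j-e_k}\big).$$ Let $K_\nu$ be Macdonald's function (the modified Bessel function of the second kind), $K_\nu(z)=\int_0^\infty e^{-z\cosh s}\cosh(\nu s)\,ds$ for $\nu\in\mathbb R$, $z>0$. For real-valued $V_j(t)$ and $u_j(t)$ put $$\|V\|_\infty=\sup_{j\in\mathbb Z^d,\,t\in[0,1]}|V_j(t)|,\qquad \|u\|_2=\Big(h^d\int_0^1\sum_{j\in\mathbb Z^d}|u_j(t)|^2\,dt\Big)^{1/2}.$$ We say that $u$ solves $(\mathrm P_{h,V})$ if $u\in C^1([0,1];\ell^2((h\mathbb Z)^d))$ and $\partial_t u_j=\Delta_{\mathrm d}u_j+V_ju_j$ for all $j\in\mathbb Z^d$ and $t\in(0,1)$. (1) There is a constant $C=C(d)>0$ such that for every $\gamma\in(0,C)$ and all finite constants $A,B,c\ge 0$ there is $h_0>0$ with the following property. If $h\in(0,h_0)$, $u$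 solves $(\mathrm P_{h,V})$, $\|V\|_\infty\le A$, $\|u\|_2\le B$ and $$h^d\sum_{j\in\mathbb Z^d}\ \prod_{k=1}^d\frac{K_{j_k}^2(\gamma/h^2)}{K_0^2(\gamma/h^2)}\ \big(|u_j(0)|^2+|u_j(1)|^2\big)\le c,$$ then $u\equiv0$ on $[0,1]$. (2) There is a constant $\mu_0=\mu_0(d)>0$ such that for every $\mu>\mu_0$ and every $h>0$: if $u$ solves $(\mathrm P_{h,V})$ with $\|V\|_\infty<\infty$, $\|u\|_2<\infty$ and $$h^d\sum_{j\in\mathbb Z^d}\ \prod_{k=1}^d\frac{K_{\mu j_k}\big(\tfrac{2}{eh^2}\big)}{K_0\big(\tfrac{2}{eh^2}\big)}\ \big(|u_j(0)|^2+|u_j(1)|^2\big)<\infty,$$ then $u\equiv0$ on $[0,1]$. -/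

import Mathlib

open scoped ENNReal NNReal

noncomputable section

/-- Macdonald's function (modified Bessel function of the second kind) of real order `ν`,
`K_ν(z) = ∫₀^∞ exp (-z cosh s) cosh (ν s) ds`, for real argument `z > 0`. -/
def macdonaldK (ν z : ℝ) : ℝ :=
  ∫ s in Set.Ioi (0 : ℝ), Real.exp (-z * Real.cosh s) * Real.cosh (ν * s)

/-- Real square summable sequences on `ℤ^d`. A function `f` on the mesh `(hℤ)^d` is encoded by
`f_j = f (h j)`; the norm of `ℓ²((hℤ)^d)` is `h ^ (d / 2)` times the norm of this space. -/
abbrev LatticeL2 (d : ℕ) : Type := lp (fun _ : Fin d → ℤ => ℝ) 2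

/-- The discrete Laplacian on `(hℤ)^d`. -/
def discreteLaplacian {d : ℕ} (h : ℝ) (f : (Fin d → ℤ) → ℝ) (j : Fin d → ℤ) : ℝ :=
  1 / h ^ 2 * ∑ k : Fin d, (f (j + Pi.single k 1) - 2 * f j + f (j - Pi.single k 1))

/-- `u ∈ C¹([0,1] : ℓ²((hℤ)^d))` solves `∂ₜ u_j = Δ u_j + V_j u_j`. -/
structure IsHeatSolution {d : ℕ} (h : ℝ) (V : (Fin d → ℤ) → ℝ → ℝ)
    (u : ℝ → LatticeL2 d) : Prop where
  contDiffOn : ContDiffOn ℝ 1 u (Set.Icc 0 1)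
  equation : ∀ t ∈ Set.Ioo (0 : ℝ) 1, ∀ j : Fin d → ℤ,
    HasDerivAt (fun s => u s j) (discreteLaplacian h (u t) j + V j t * u t j) t

/-- `‖V‖_∞`, the supremum of `|V_j(t)|` over `j ∈ ℤ^d` and `t ∈ [0,1]`. -/
def potentialNorm {d : ℕ} (V : (Fin d → ℤ) → ℝ → ℝ) : ℝ≥0∞ :=
  ⨆ j : Fin d → ℤ, ⨆ t ∈ Set.Icc (0 : ℝ) 1, ENNReal.ofReal |V j t|

/-- `‖u‖₂ = (h^d ∫₀¹ ∑_j |u_j(t)|² dt)^{1/2}`. -/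
def spaceTimeNorm {d : ℕ} (h : ℝ) (u : ℝ → LatticeL2 d) : ℝ≥0∞ :=
  (ENNReal.ofReal (h ^ d) *
    ∫⁻ t in Set.Icc (0 : ℝ) 1, ∑' j : Fin d → ℤ, ENNReal.ofReal (|u t j| ^ 2)) ^ (1 / 2 : ℝ)

/-- `h^d ∑_j w_j (|u_j(0)|² + |u_j(1)|²)` for a weight `w ≥ 0`. -/
def twoTimeEnergy {d : ℕ} (h : ℝ) (w : (Fin d → ℤ) → ℝ) (u : ℝ → LatticeL2 d) : ℝ≥0∞ :=
  ENNReal.ofReal (h ^ d) *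
    ∑' j : Fin d → ℤ, ENNReal.ofReal (w j * (|u 0 j| ^ 2 + |u 1 j| ^ 2))

/-- The weight `∏_k K_{j_k}²(γ/h²) / K_0²(γ/h²)`. -/
def continuumWeight {d : ℕ} (γ h : ℝ) (j : Fin d → ℤ) : ℝ :=
  ∏ k : Fin d, macdonaldK (j k) (γ / h ^ 2) ^ 2 / macdonaldK 0 (γ / h ^ 2) ^ 2

/-- The weight `∏_k K_{μ j_k}(2/(e h²)) / K_0(2/(e h²))`. -/
def discreteWeight {d : ℕ} (μ h : ℝ) (j : Fin d → ℤ) : ℝ :=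
  ∏ k : Fin d, macdonaldK ((j k : ℝ) * μ) (2 / (Real.exp 1 * h ^ 2)) /
    macdonaldK 0 (2 / (Real.exp 1 * h ^ 2))

end

/-! For fixed h the discrete Laplacian is bounded on ℓ², so the equation is an ODE in a Hilbert
space, coupled along the first coordinate. The rescaled slices v_k = h^{2k} u(s+k,·), k ≥ 0, satisfy
v_{k+1}' = v_k + τ v_{k+2} + O(A‖v_{k+1}‖) with τ = h⁻⁴ (`IsHeatSolution.isLadder`). Both Macdonald
weights dominate factorial growth in the first coordinate, so at times 0 and 1 the slices decay like
1/(k! 256^k) after rescaling. It remains to show that such a one-sided chain vanishes at time 1/2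
(`IsLadder.eq_zero_at_half`); Gronwall then spreads this to [0,1].

The tool is a Carleman inequality. For x_k = w_k(t) v_k the equation reads x' = (S + Z)x + error,
where S + Z is the diagonal p = w'/w plus a shift with coefficients b_k = w_{k+1}/w_k, S is its
symmetric and Z its antisymmetric part. Differentiating ⟨Sx, x⟩ and completing squares bounds q∫‖x‖²
by boundary terms and the squared error, provided S' + [S, Z] ≥ q. The commutator contains ½(b_i² −
b_{i−1}²), which is positive for factorial weights. The upward coupling τ v_{k+2} is part of the
error: it costs only τ/θ when all b_k ≥ θ.

The inequality is used twice. Truncating the chain at N needs decay inside the time interval,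
whereas boundedness of u gives only ‖v_k‖ ≤ M₀ T^{-k}. So `IsLadder.interior_decay` first takes
weights that are factorial up to a large index and then slow down to a geometric rate below T, with
bounds independent of that index. Factorial decay being now known inside, `IsLadder.carleman_bell`
uses the weights (n+m)! e^{(n+m)(4−4(t−1/2)²)}. As m → ∞ they grow faster at t = 1/2 than at the
ends, which is incompatible with v_1(1/2) ≠ 0. -/

noncomputable section

/-! ### The commutator inequality at a fixed time -/

section Carleman

variable {H : Type*} [NormedAddCommGroup H] [InnerProductSpace ℝ H]

/-- The positivity of `‖X - S‖² + 2 ⟪X, S⟫` at one site, up to a telescoping term. -/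
theorem carleman_site (x₀ x₁ x₂ y₁ y₂ : H) (p₁ p₂ b₀ b₁ : ℝ) :
    1 / 2 * (b₁ ^ 2 - b₀ ^ 2) * ‖x₁‖ ^ 2 + b₁ * (p₂ - p₁) * inner ℝ x₂ x₁
      + ((-(b₁ * p₂) * inner ℝ x₂ x₁ + b₁ * inner ℝ y₂ x₁ - 1 / 2 * b₁ ^ 2 * ‖x₂‖ ^ 2
          - 1 / 2 * b₁ ^ 2 * ‖x₁‖ ^ 2)
        - (-(b₀ * p₁) * inner ℝ x₁ x₀ + b₀ * inner ℝ y₁ x₀ - 1 / 2 * b₀ ^ 2 * ‖x₁‖ ^ 2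
          - 1 / 2 * b₀ ^ 2 * ‖x₀‖ ^ 2))
      ≤ 2 * p₁ * inner ℝ x₁ y₁ + b₁ * inner ℝ y₂ x₁ + b₁ * inner ℝ x₂ y₁
        + ‖y₁ - p₁ • x₁ - b₀ • x₀‖ ^ 2 := by
  -- The squares are the components at this site of y − Zx and of Sx, with S the symmetric and Z the
  -- antisymmetric part of diagonal plus shift: ‖y − Sx − Zx‖² + 2⟨Sx, y⟩ = ‖y − Zx‖² + ‖Sx‖² +
  -- 2⟨Sx, Zx⟩, and the rest telescopes.
  have key : 0 ≤ ‖y₁ - (b₀ / 2) • x₀ + (b₁ / 2) • x₂‖ ^ 2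
      + ‖p₁ • x₁ + (b₀ / 2) • x₀ + (b₁ / 2) • x₂‖ ^ 2 := by positivity
  simp only [← real_inner_self_eq_norm_sq, inner_add_left, inner_add_right, inner_sub_left,
    inner_sub_right, real_inner_smul_left, real_inner_smul_right] at key ⊢
  rw [real_inner_comm x₀ x₁, real_inner_comm x₀ x₂, real_inner_comm x₀ y₁,
    real_inner_comm x₁ x₂, real_inner_comm x₁ y₁, real_inner_comm x₂ y₁] at *
  nlinarith [key]

/-- Summation of `carleman_site` over a finite chain with vanishing ends. -/
theorem carleman_sum (n : ℕ) (x y : ℕ → H) (p p' b : ℕ → ℝ) (q : ℝ)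
    (hx₀ : x 0 = 0) (hxn : x n = 0) (hxn' : x (n + 1) = 0)
    (hb : ∀ i, 0 ≤ b i)
    (hq : ∀ i, q ≤ p' (i + 1) + 1 / 2 * (b (i + 1) ^ 2 - b i ^ 2)
      - (b (i + 1) * |p (i + 2) - p (i + 1)| + b i * |p (i + 1) - p i|)) :
    q * ∑ i ∈ Finset.range n, ‖x (i + 1)‖ ^ 2 ≤
      ∑ i ∈ Finset.range n,
        ((p' (i + 1) * ‖x (i + 1)‖ ^ 2 + p (i + 1) * (2 * inner ℝ (x (i + 1)) (y (i + 1))))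
        + (b (i + 1) * (p (i + 2) - p (i + 1)) * inner ℝ (x (i + 2)) (x (i + 1))
          + b (i + 1) * (inner ℝ (x (i + 2)) (y (i + 1)) + inner ℝ (y (i + 2)) (x (i + 1)))))
      + ∑ i ∈ Finset.range n, ‖y (i + 1) - p (i + 1) • x (i + 1) - b i • x i‖ ^ 2 := by
  let G : ℕ → ℝ := fun i => -(b i * p (i + 1)) * inner ℝ (x (i + 1)) (x i)
    + b i * inner ℝ (y (i + 1)) (x i) - 1 / 2 * b i ^ 2 * ‖x (i + 1)‖ ^ 2
    - 1 / 2 * b i ^ 2 * ‖x i‖ ^ 2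
  -- The cross terms with differences of `p` are split between two neighbouring sites; `J` carries
  -- the share of the upper one.
  let J : ℕ → ℝ := fun i => b i * |p (i + 1) - p i| * ‖x (i + 1)‖ ^ 2
  have hG := Finset.sum_range_sub G n
  have hJ := Finset.sum_range_sub J n
  have hGn : G n = 0 := by simp [G, hxn, hxn']
  have hG0 : G 0 ≤ 0 := by
    simp only [G, hx₀, inner_zero_right, norm_zero]
    nlinarith [mul_nonneg (sq_nonneg (b 0)) (sq_nonneg ‖x (0 + 1)‖)]
  have hJn : J n = 0 := by simp [J, hxn']
  have hJ0 : 0 ≤ J 0 := mul_nonneg (mul_nonneg (hb _) (abs_nonneg _)) (sq_nonneg _)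
  have hsite : ∀ i ∈ Finset.range n, q * ‖x (i + 1)‖ ^ 2 + (G (i + 1) - G i)
      - (J (i + 1) - J i) ≤
      ((p' (i + 1) * ‖x (i + 1)‖ ^ 2 + p (i + 1) * (2 * inner ℝ (x (i + 1)) (y (i + 1))))
        + (b (i + 1) * (p (i + 2) - p (i + 1)) * inner ℝ (x (i + 2)) (x (i + 1))
          + b (i + 1) * (inner ℝ (x (i + 2)) (y (i + 1)) + inner ℝ (y (i + 2)) (x (i + 1)))))
      + ‖y (i + 1) - p (i + 1) • x (i + 1) - b i • x i‖ ^ 2 := by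
    intro i _
    have h1 := carleman_site (x i) (x (i + 1)) (x (i + 2)) (y (i + 1)) (y (i + 2))
      (p (i + 1)) (p (i + 2)) (b i) (b (i + 1))
    have h2 := mul_le_mul_of_nonneg_right (hq i) (sq_nonneg ‖x (i + 1)‖)
    -- The factor 2 collects two equal terms: one from the commutator, one from the time derivative
    -- of `b`.
    have h3 : -(b (i + 1) * |p (i + 2) - p (i + 1)| * (‖x (i + 2)‖ ^ 2 + ‖x (i + 1)‖ ^ 2))
        ≤ 2 * (b (i + 1) * (p (i + 2) - p (i + 1)) * inner ℝ (x (i + 2)) (x (i + 1))) := by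
      have ha : |2 * ((p (i + 2) - p (i + 1)) * inner ℝ (x (i + 2)) (x (i + 1)))|
          ≤ |p (i + 2) - p (i + 1)| * (‖x (i + 2)‖ ^ 2 + ‖x (i + 1)‖ ^ 2) := by
        rw [abs_mul, abs_mul, abs_two]
        have hcs := abs_real_inner_le_norm (x (i + 2)) (x (i + 1))
        have : 2 * |inner ℝ (x (i + 2)) (x (i + 1))| ≤ ‖x (i + 2)‖ ^ 2 + ‖x (i + 1)‖ ^ 2 := by
          nlinarith [sq_nonneg (‖x (i + 2)‖ - ‖x (i + 1)‖)]
        nlinarith [mul_le_mul_of_nonneg_left this (abs_nonneg (p (i + 2) - p (i + 1)))]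
      have hbi := hb (i + 1)
      have := mul_le_mul_of_nonneg_left (abs_le.1 ha).1 hbi
      linarith
    simp only [G, J, show i + 1 + 1 = i + 2 from rfl] at *
    linarith
  have hsum := Finset.sum_le_sum hsite
  rw [Finset.sum_sub_distrib, Finset.sum_add_distrib, Finset.sum_add_distrib, hG, hJ,
    ← Finset.mul_sum] at hsum
  linarith

end Carleman

/-! ### Carleman inequality for truncated weighted chains -/

section Ladder

variable {H : Type*} [NormedAddCommGroup H] [InnerProductSpace ℝ H]

/-- A chain of curves with `∂ₜ v_{n+1} = v_n + τ v_{n+2} + O(A |v_{n+1}|)` on `(0, 1)`. -/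
structure IsLadder (A τ : ℝ) (v v' : ℕ → ℝ → H) : Prop where
  continuousOn : ∀ n, ContinuousOn (v n) (Set.Icc 0 1)
  hasDerivAt : ∀ n, ∀ t ∈ Set.Ioo (0 : ℝ) 1, HasDerivAt (v n) (v' n t) t
  residual_le : ∀ n, ∀ t ∈ Set.Ioo (0 : ℝ) 1,
    ‖v' (n + 1) t - v n t - τ • v (n + 2) t‖ ≤ A * ‖v (n + 1) t‖

/-- A family of positive weights `w_n` with logarithmic derivatives `p_n`, for which the
commutator of the weighted operator is bounded below by `q`. -/
structure IsCarlemanWeight (q θ : ℝ) (w p p' : ℕ → ℝ → ℝ) : Prop where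
  pos : ∀ n t, 0 < w n t
  hasDerivAt : ∀ n t, HasDerivAt (w n) (p n t * w n t) t
  hasDerivAt_log : ∀ n t, HasDerivAt (p n) (p' n t) t
  ratio_ge : ∀ n, ∀ t ∈ Set.Ioo (0 : ℝ) 1, θ * w n t ≤ w (n + 1) t
  commutator_ge : ∀ i, ∀ t ∈ Set.Ioo (0 : ℝ) 1,
    q ≤ p' (i + 1) t + 1 / 2 * ((w (i + 2) t / w (i + 1) t) ^ 2 - (w (i + 1) t / w i t) ^ 2)
      - (w (i + 2) t / w (i + 1) t * |p (i + 2) t - p (i + 1) t|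
        + w (i + 1) t / w i t * |p (i + 1) t - p i t|)

/-- The boundary terms of the Carleman inequality at time `t`. -/
def carlemanBoundary (w p : ℕ → ℝ → ℝ) (v : ℕ → ℝ → H) (N : ℕ) (t : ℝ) : ℝ :=
  ∑ i ∈ Finset.range N, (|p (i + 1) t| * (w (i + 1) t ^ 2 * ‖v (i + 1) t‖ ^ 2)
    + w (i + 2) t ^ 2 * (‖v (i + 2) t‖ * ‖v (i + 1) t‖))

theorem norm_add_three_sq_le {E : Type*} [SeminormedAddCommGroup E] (a b c : E) :
    ‖a + b + c‖ ^ 2 ≤ 3 * (‖a‖ ^ 2 + ‖b‖ ^ 2 + ‖c‖ ^ 2) := by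
  have h : ‖a + b + c‖ ≤ ‖a‖ + ‖b‖ + ‖c‖ := norm_add₃_le
  have h' := pow_le_pow_left₀ (norm_nonneg _) h 2
  nlinarith [sq_nonneg (‖a‖ - ‖b‖), sq_nonneg (‖a‖ - ‖c‖), sq_nonneg (‖b‖ - ‖c‖)]

variable {A τ q θ : ℝ} {v v' : ℕ → ℝ → H} {w p p' : ℕ → ℝ → ℝ}

/-- The weighted chain, cut off to the sites `1, …, N`. -/
def cutChain (N : ℕ) (w : ℕ → ℝ → ℝ) (v : ℕ → ℝ → H) (c : ℕ) (t : ℝ) : H :=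
  if 1 ≤ c ∧ c ≤ N then w c t • v c t else 0

theorem cutChain_succ_of_lt {N i : ℕ} (h : i < N) (t : ℝ) :
    cutChain N w v (i + 1) t = w (i + 1) t • v (i + 1) t :=
  if_pos ⟨by omega, by omega⟩

theorem cutChain_of_gt {N c : ℕ} (h : N < c) (t : ℝ) : cutChain N w v c t = 0 :=
  if_neg (by omega)

theorem cutChain_zero (N : ℕ) (t : ℝ) : cutChain N w v 0 t = 0 := if_neg (by omega)

theorem norm_cutChain_le (hw : IsCarlemanWeight q θ w p p') (N c : ℕ) (t : ℝ) :
    ‖cutChain N w v c t‖ ≤ w c t * ‖v c t‖ := by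
  have := hw.pos c t
  unfold cutChain
  split_ifs
  · rw [norm_smul, Real.norm_of_nonneg this.le]
  · rw [norm_zero]; positivity

theorem cutChain_hasDerivAt (hw : IsCarlemanWeight q θ w p p') (hv : IsLadder A τ v v')
    (N c : ℕ) {t : ℝ} (ht : t ∈ Set.Ioo (0 : ℝ) 1) :
    HasDerivAt (cutChain N w v c)
      (p c t • cutChain N w v c t + cutChain N w v' c t) t := by
  by_cases h : 1 ≤ c ∧ c ≤ N
  · have he : ∀ u : ℕ → ℝ → H, cutChain N w u c = fun s => w c s • u c s := fun u => by
      funext s; exact if_pos h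
    rw [he v, he v']
    refine ((hw.hasDerivAt c t).smul (hv.hasDerivAt c t ht)).congr_deriv ?_
    simp only [smul_smul]
    rw [add_comm]
  · have he : ∀ u : ℕ → ℝ → H, cutChain N w u c = fun _ => 0 := fun u => by
      funext s; exact if_neg h
    rw [he v, he v']
    simpa using hasDerivAt_const t (0 : H)

/-- The sum of the squared residuals of the cut-off weighted chain. -/
theorem sum_residual_sq_le (hw : IsCarlemanWeight q θ w p p') (hv : IsLadder A τ v v')
    (hθ : 0 < θ) (N : ℕ) {t : ℝ} (ht : t ∈ Set.Ioo (0 : ℝ) 1) :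
    ∑ i ∈ Finset.range (N + 2),
      ‖cutChain (N + 1) w v' (i + 1) t
        - (w (i + 1) t / w i t) • cutChain (N + 1) w v i t‖ ^ 2 ≤
      3 * (A ^ 2 + (τ / θ) ^ 2) * ∑ i ∈ Finset.range (N + 1), w (i + 1) t ^ 2 * ‖v (i + 1) t‖ ^ 2
      + (3 * (w 1 t ^ 2 * ‖v 0 t‖ ^ 2) + 3 * τ ^ 2 * (w (N + 1) t ^ 2 * ‖v (N + 2) t‖ ^ 2)
        + w (N + 2) t ^ 2 * ‖v (N + 1) t‖ ^ 2) := by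
  have hmain : ∀ i, ‖v' (i + 1) t‖ ^ 2 ≤
      3 * (A ^ 2 * ‖v (i + 1) t‖ ^ 2 + ‖v i t‖ ^ 2 + τ ^ 2 * ‖v (i + 2) t‖ ^ 2) := fun i => by
    have h := norm_add_three_sq_le (v' (i + 1) t - v i t - τ • v (i + 2) t) (v i t)
      (τ • v (i + 2) t)
    have h2 := pow_le_pow_left₀ (norm_nonneg _) (hv.residual_le i t ht) 2
    rw [show v' (i + 1) t - v i t - τ • v (i + 2) t + v i t + τ • v (i + 2) t = v' (i + 1) t by
      abel, norm_smul, mul_pow, Real.norm_eq_abs, sq_abs] at h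
    rw [mul_pow] at h2
    linarith
  have hmain' : ∀ i, ‖v' (i + 1) t - v i t‖ ^ 2 ≤
      3 * (A ^ 2 * ‖v (i + 1) t‖ ^ 2 + τ ^ 2 * ‖v (i + 2) t‖ ^ 2) := fun i => by
    have h := norm_add_three_sq_le (v' (i + 1) t - v i t - τ • v (i + 2) t) 0
      (τ • v (i + 2) t)
    have h2 := pow_le_pow_left₀ (norm_nonneg _) (hv.residual_le i t ht) 2
    rw [add_zero, sub_add_cancel, norm_zero, norm_smul, mul_pow, Real.norm_eq_abs,
      sq_abs] at h
    rw [mul_pow] at h2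
    linarith
  -- One site above the cut-off the derivative part is zero, but the shift still feeds in site N +
  -- 1.
  have hlast : ‖cutChain (N + 1) w v' (N + 1 + 1) t
        - (w (N + 1 + 1) t / w (N + 1) t) • cutChain (N + 1) w v (N + 1) t‖ ^ 2
      = w (N + 2) t ^ 2 * ‖v (N + 1) t‖ ^ 2 := by
    rw [cutChain_of_gt (by omega), cutChain_succ_of_lt (by omega), zero_sub, norm_neg, smul_smul,
      div_mul_cancel₀ _ (hw.pos _ _).ne', norm_smul, mul_pow, Real.norm_eq_abs, sq_abs]
  -- The lower bound θ on the ratios turns the upward coupling into a multiple of the weighted norm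
  -- one site up.
  have hshift : ∀ i, w (i + 1) t ^ 2 * (τ ^ 2 * ‖v (i + 2) t‖ ^ 2) ≤
      (τ / θ) ^ 2 * (w (i + 2) t ^ 2 * ‖v (i + 2) t‖ ^ 2) := fun i => by
    have h1 := hw.ratio_ge (i + 1) t ht
    have h2 : w (i + 1) t ≤ w (i + 2) t / θ := by
      rw [le_div_iff₀ hθ]; linarith
    have h3 := pow_le_pow_left₀ (hw.pos _ _).le h2 2
    calc _ = w (i + 1) t ^ 2 * (τ ^ 2 * ‖v (i + 2) t‖ ^ 2) := rfl
      _ ≤ (w (i + 2) t / θ) ^ 2 * (τ ^ 2 * ‖v (i + 2) t‖ ^ 2) := by gcongr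
      _ = _ := by ring
  -- Site 1 has lost its lower neighbour to the cut-off, so ‖v_0‖ enters as an error exactly there.
  have hbody : ∀ i ∈ Finset.range (N + 1), ‖cutChain (N + 1) w v' (i + 1) t
        - (w (i + 1) t / w i t) • cutChain (N + 1) w v i t‖ ^ 2 ≤
      3 * A ^ 2 * (w (i + 1) t ^ 2 * ‖v (i + 1) t‖ ^ 2)
      + 3 * (w (i + 1) t ^ 2 * (τ ^ 2 * ‖v (i + 2) t‖ ^ 2))
      + (if i = 0 then 3 * (w 1 t ^ 2 * ‖v 0 t‖ ^ 2) else 0) := by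
    intro i hi
    rw [Finset.mem_range] at hi
    rw [cutChain_succ_of_lt hi]
    have hpos := sq_nonneg (w (i + 1) t)
    rcases i with _ | i
    · rw [cutChain_zero, smul_zero, sub_zero, norm_smul, mul_pow, Real.norm_eq_abs, sq_abs,
        if_pos rfl]
      have := mul_le_mul_of_nonneg_left (hmain 0) hpos
      simp only [zero_add] at *
      linarith
    · rw [cutChain_succ_of_lt (by omega), smul_smul, div_mul_cancel₀ _ (hw.pos _ _).ne',
        ← smul_sub, norm_smul, mul_pow, Real.norm_eq_abs, sq_abs, if_neg (by omega)]
      have := mul_le_mul_of_nonneg_left (hmain' (i + 1)) hpos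
      linarith
  have hS : ∑ i ∈ Finset.range (N + 1), w (i + 1) t ^ 2 * (τ ^ 2 * ‖v (i + 2) t‖ ^ 2) ≤
      (τ / θ) ^ 2 * ∑ i ∈ Finset.range (N + 1), w (i + 1) t ^ 2 * ‖v (i + 1) t‖ ^ 2
      + τ ^ 2 * (w (N + 1) t ^ 2 * ‖v (N + 2) t‖ ^ 2) := by
    rw [Finset.sum_range_succ, Finset.sum_range_succ', mul_add, Finset.mul_sum]
    have h1 := Finset.sum_le_sum fun i (_ : i ∈ Finset.range N) => hshift i
    have h2 : 0 ≤ (τ / θ) ^ 2 * (w (0 + 1) t ^ 2 * ‖v (0 + 1) t‖ ^ 2) := by positivity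
    simp only [show ∀ i, i + 1 + 1 = i + 2 from fun _ => rfl] at *
    linarith
  rw [Finset.sum_range_succ, hlast]
  have hsum := Finset.sum_le_sum hbody
  rw [Finset.sum_add_distrib, Finset.sum_add_distrib, ← Finset.mul_sum, ← Finset.mul_sum,
    Finset.sum_ite_eq' (Finset.range (N + 1)) 0, if_pos (by simp)] at hsum
  linarith

/-- The Carleman inequality for a ladder. -/
theorem IsLadder.carleman (hw : IsCarlemanWeight q θ w p p') (hv : IsLadder A τ v v')
    (hθ : 0 < θ) (N : ℕ) (φ : ℝ → ℝ) (hφ : ContinuousOn φ (Set.Icc 0 1))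
    (hle : ∀ t ∈ Set.Ioo (0 : ℝ) 1, φ t ≤ (q - 3 * (A ^ 2 + (τ / θ) ^ 2)) *
        ∑ i ∈ Finset.range (N + 1), w (i + 1) t ^ 2 * ‖v (i + 1) t‖ ^ 2
      - (3 * (w 1 t ^ 2 * ‖v 0 t‖ ^ 2) + 3 * τ ^ 2 * (w (N + 1) t ^ 2 * ‖v (N + 2) t‖ ^ 2)
        + w (N + 2) t ^ 2 * ‖v (N + 1) t‖ ^ 2)) :
    ∫ t in (0 : ℝ)..1, φ t ≤
      carlemanBoundary w p v (N + 2) 0 + carlemanBoundary w p v (N + 2) 1 := by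
  let x := cutChain (N + 1) w v
  let b : ℕ → ℝ → ℝ := fun n t => w (n + 1) t / w n t
  -- The quadratic form ⟨Sx, x⟩ of the symmetric part.
  let D : ℝ → ℝ := fun t => ∑ i ∈ Finset.range (N + 2),
    (p (i + 1) t * ‖x (i + 1) t‖ ^ 2 + b (i + 1) t * inner ℝ (x (i + 2) t) (x (i + 1) t))
  let y : ℕ → ℝ → H := fun c t => p c t • x c t + cutChain (N + 1) w v' c t
  let D' : ℝ → ℝ := fun t => ∑ i ∈ Finset.range (N + 2),
    ((p' (i + 1) t * ‖x (i + 1) t‖ ^ 2 + p (i + 1) t * (2 * inner ℝ (x (i + 1) t) (y (i + 1) t)))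
      + (b (i + 1) t * (p (i + 2) t - p (i + 1) t) * inner ℝ (x (i + 2) t) (x (i + 1) t)
        + b (i + 1) t * (inner ℝ (x (i + 2) t) (y (i + 1) t)
          + inner ℝ (y (i + 2) t) (x (i + 1) t))))
  have hwc : ∀ n, Continuous (w n) := fun n =>
    continuous_iff_continuousAt.2 fun t => (hw.hasDerivAt n t).continuousAt
  have hpc : ∀ n, Continuous (p n) := fun n =>
    continuous_iff_continuousAt.2 fun t => (hw.hasDerivAt_log n t).continuousAt
  have hbc : ∀ n, Continuous (b n) := fun n =>
    (hwc (n + 1)).div (hwc n) fun t => (hw.pos n t).ne'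
  have hvc := hv.continuousOn
  have hxc : ∀ n, ContinuousOn (x n) (Set.Icc 0 1) := fun n => by
    by_cases h : 1 ≤ n ∧ n ≤ N + 1
    · have : x n = fun s => w n s • v n s := by funext s; exact if_pos h
      rw [this]
      exact (hwc n).continuousOn.smul (hvc n)
    · have : x n = fun _ => 0 := by funext s; exact if_neg h
      rw [this]; exact continuousOn_const
  have hDc : ContinuousOn D (Set.Icc 0 1) := by
    refine continuousOn_finsetSum _ fun i _ => ?_
    exact ((hpc _).continuousOn.mul ((hxc _).norm.pow 2)).add
      ((hbc _).continuousOn.mul ((hxc _).inner (𝕜 := ℝ) (hxc _)))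
  have hDd : ∀ t ∈ Set.Ioo (0 : ℝ) 1, HasDerivAt D (D' t) t := by
    intro t ht
    refine HasDerivAt.fun_sum fun i _ => ?_
    have hx : ∀ c, HasDerivAt (x c) (y c t) t := fun c =>
      cutChain_hasDerivAt hw hv (N + 1) c ht
    have hb : HasDerivAt (b (i + 1)) (b (i + 1) t * (p (i + 2) t - p (i + 1) t)) t := by
      have h := (hw.hasDerivAt (i + 2) t).div (hw.hasDerivAt (i + 1) t) (hw.pos _ _).ne'
      refine h.congr_deriv ?_
      have := (hw.pos (i + 1) t).ne'
      simp only [b, show i + 1 + 1 = i + 2 from rfl]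
      field_simp
    have hsq := (hx (i + 1)).norm_sq
    exact ((hw.hasDerivAt_log (i + 1) t).mul hsq).add
      (hb.mul ((hx (i + 2)).inner ℝ (hx (i + 1))))
  have hD_le : ∀ t, |D t| ≤ carlemanBoundary w p v (N + 2) t := by
    intro t
    refine (Finset.abs_sum_le_sum_abs _ _).trans (Finset.sum_le_sum fun i _ => ?_)
    have h1 : ‖x (i + 1) t‖ ≤ w (i + 1) t * ‖v (i + 1) t‖ := norm_cutChain_le hw _ _ _
    have h2 : ‖x (i + 2) t‖ ≤ w (i + 2) t * ‖v (i + 2) t‖ := norm_cutChain_le hw _ _ _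
    have w1 := hw.pos (i + 1) t
    have w2 := hw.pos (i + 2) t
    refine (abs_add_le _ _).trans (add_le_add ?_ ?_)
    · rw [abs_mul, abs_of_nonneg (sq_nonneg ‖x (i + 1) t‖), ← mul_pow]
      gcongr
    · have hb : 0 < b (i + 1) t := div_pos w2 w1
      rw [abs_mul, abs_of_pos hb]
      calc b (i + 1) t * |inner ℝ (x (i + 2) t) (x (i + 1) t)|
          ≤ b (i + 1) t * (‖x (i + 2) t‖ * ‖x (i + 1) t‖) := by
            gcongr; exact abs_real_inner_le_norm _ _
        _ ≤ b (i + 1) t * ((w (i + 2) t * ‖v (i + 2) t‖) * (w (i + 1) t * ‖v (i + 1) t‖)) := by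
            gcongr
        _ = _ := by
            simp only [b, show i + 1 + 1 = i + 2 from rfl]
            field_simp
  -- Only a continuous lower bound φ ≤ D' is integrated; nothing is known about the integrability of
  -- D' itself.
  have hint := intervalIntegral.integral_le_sub_of_hasDeriv_right_of_le (a := 0) (b := 1)
    (g := D) (g' := D') (φ := φ) zero_le_one hDc
    (fun t ht => (hDd t ht).hasDerivWithinAt) ?_ ?_
  · have h0 := (abs_le.1 (hD_le 0)).1
    have h1 := (abs_le.1 (hD_le 1)).2
    linarith
  · exact hφ.integrableOn_Icc
  · intro t ht
    have halg := carleman_sum (N + 2) (fun c => x c t) (fun c => y c t) (fun c => p c t)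
      (fun c => p' c t) (fun c => b c t) q (cutChain_zero _ _)
      (cutChain_of_gt (by omega) _) (cutChain_of_gt (by omega) _)
      (fun i => (div_pos (hw.pos _ _) (hw.pos _ _)).le) (fun i => hw.commutator_ge i t ht)
    have hres := sum_residual_sq_le hw hv hθ N ht
    have hr : ∀ i, y (i + 1) t - p (i + 1) t • x (i + 1) t - b i t • x i t
        = cutChain (N + 1) w v' (i + 1) t
          - (w (i + 1) t / w i t) • cutChain (N + 1) w v i t := fun i => by
      simp only [y, b, x]; rw [add_sub_cancel_left]
    simp only [hr] at halg
    have hsum : ∑ i ∈ Finset.range (N + 2), ‖x (i + 1) t‖ ^ 2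
        = ∑ i ∈ Finset.range (N + 1), w (i + 1) t ^ 2 * ‖v (i + 1) t‖ ^ 2 := by
      rw [Finset.sum_range_succ, show x (N + 1 + 1) t = 0 from cutChain_of_gt (by omega) _]
      simp only [norm_zero, ne_eq, OfNat.ofNat_ne_zero, not_false_eq_true, zero_pow, add_zero]
      refine Finset.sum_congr rfl fun i hi => ?_
      rw [show x (i + 1) t = _ from cutChain_succ_of_lt (Finset.mem_range.1 hi) t, norm_smul,
        mul_pow, Real.norm_eq_abs, sq_abs]
    rw [hsum] at halg
    simp only [D']
    linarith [hle t ht]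

end Ladder

/-! ### Factorial decay inside the time interval -/

section InteriorDecay

variable {H : Type*} [NormedAddCommGroup H] [InnerProductSpace ℝ H]

/-- Geometric decay of w_n‖v_n‖ beats the linear growth of p_n and of the ratios. The bound is
independent of N, which permits N → ∞. -/
theorem carlemanBoundary_le {E : Type*} [NormedAddCommGroup E] {w p : ℕ → ℝ → ℝ}
    {v : ℕ → ℝ → E} {t P K : ℝ}
    (hw : ∀ n, 0 ≤ w n t) (hP : 0 ≤ P) (hK : 0 ≤ K) (hp : ∀ n : ℕ, |p n t| ≤ P * (n + 1))
    (hratio : ∀ n : ℕ, w (n + 1) t ≤ P * (n + 1) * w n t)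
    (hdecay : ∀ n, w n t * ‖v n t‖ ≤ K * (1 / 2) ^ n) (N : ℕ) :
    carlemanBoundary w p v N t ≤ 2 * P * K ^ 2 := by
  have hterm : ∀ i : ℕ, |p (i + 1) t| * (w (i + 1) t ^ 2 * ‖v (i + 1) t‖ ^ 2)
      + w (i + 2) t ^ 2 * (‖v (i + 2) t‖ * ‖v (i + 1) t‖) ≤ P * K ^ 2 * (1 / 2) ^ i := by
    intro i
    have hd1 := hdecay (i + 1)
    have hd2 := hdecay (i + 2)
    have n1 : 0 ≤ w (i + 1) t * ‖v (i + 1) t‖ := mul_nonneg (hw _) (norm_nonneg _)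
    have n2 : 0 ≤ w (i + 2) t * ‖v (i + 2) t‖ := mul_nonneg (hw _) (norm_nonneg _)
    have hp1 := hp (i + 1)
    have hr := hratio (i + 1)
    push_cast at hp1 hr
    have h1 : |p (i + 1) t| * (w (i + 1) t ^ 2 * ‖v (i + 1) t‖ ^ 2)
        ≤ P * (i + 1 + 1) * (K * (1 / 2) ^ (i + 1)) ^ 2 := by
      rw [← mul_pow]; gcongr
    have h2 : w (i + 2) t ^ 2 * (‖v (i + 2) t‖ * ‖v (i + 1) t‖) ≤
        P * (i + 1 + 1) * (K * (1 / 2) ^ (i + 2)) * (K * (1 / 2) ^ (i + 1)) := by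
      calc w (i + 2) t ^ 2 * (‖v (i + 2) t‖ * ‖v (i + 1) t‖)
          = w (i + 2) t * ((w (i + 2) t * ‖v (i + 2) t‖) * ‖v (i + 1) t‖) := by ring
        _ ≤ (P * (i + 1 + 1) * w (i + 1) t) * ((w (i + 2) t * ‖v (i + 2) t‖) * ‖v (i + 1) t‖) :=
            mul_le_mul_of_nonneg_right hr (mul_nonneg n2 (norm_nonneg _))
        _ = P * (i + 1 + 1) * (w (i + 2) t * ‖v (i + 2) t‖) * (w (i + 1) t * ‖v (i + 1) t‖) := by
            ring
        _ ≤ _ := by gcongr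
    have hi : ((i : ℝ) + 2) ≤ 2 * 2 ^ i := by
      have := one_add_mul_le_pow (a := (1 : ℝ)) (by norm_num) i
      norm_num at this
      have h2 : (1 : ℝ) ≤ 2 ^ i := one_le_pow₀ (by norm_num)
      linarith
    have hpow : (2 : ℝ) ^ i * (1 / 2) ^ i = 1 := by rw [← mul_pow]; norm_num
    have hhalf : (0 : ℝ) < (1 / 2) ^ i := by positivity
    have h3 : ((i : ℝ) + 2) * (1 / 2) ^ i ≤ 2 := by nlinarith
    have h4 : P * K ^ 2 * (1 / 2) ^ i * ((((i : ℝ) + 2) * (1 / 2) ^ i) * (3 / 8)) ≤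
        P * K ^ 2 * (1 / 2) ^ i * 1 := by
      gcongr; linarith
    calc _ ≤ _ := add_le_add h1 h2
      _ = P * K ^ 2 * (1 / 2) ^ i * ((((i : ℝ) + 2) * (1 / 2) ^ i) * (3 / 8)) := by ring
      _ ≤ _ := by linarith
  calc carlemanBoundary w p v N t ≤ ∑ i ∈ Finset.range N, P * K ^ 2 * (1 / 2) ^ i :=
        Finset.sum_le_sum fun i _ => hterm i
    _ = P * K ^ 2 * ∑ i ∈ Finset.range N, (1 / 2 : ℝ) ^ i := by rw [Finset.mul_sum]
    _ ≤ P * K ^ 2 * 2 := by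
        gcongr
        exact sum_geometric_two_le N
    _ = _ := by ring

/-- Ratios that follow `(n + 1) β` for small `n` and descend slowly to `θ`. -/
def capRatio (β θ : ℝ) (M n : ℕ) : ℝ :=
  √(min (((n + 1) * β) ^ 2) (θ ^ 2 + (M - n : ℕ)))

/-- The weight with successive ratios `capRatio`. -/
def capWeight (β θ : ℝ) (M n : ℕ) : ℝ := ∏ i ∈ Finset.range n, capRatio β θ M i

section Cap

variable {β θ : ℝ} (M n : ℕ)

theorem capRatio_sq : capRatio β θ M n ^ 2 = min (((n + 1) * β) ^ 2) (θ ^ 2 + (M - n : ℕ)) :=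
  Real.sq_sqrt (le_min (by positivity) (by positivity))

theorem capRatio_le (hβ : 0 < β) : capRatio β θ M n ≤ (n + 1) * β :=
  Real.sqrt_le_iff.2 ⟨by positivity, min_le_left _ _⟩

theorem le_capRatio (hθ : 0 < θ) (hθβ : θ ≤ β) : θ ≤ capRatio β θ M n := by
  refine Real.le_sqrt_of_sq_le (le_min ?_ ?_)
  · have : (0 : ℝ) ≤ n := n.cast_nonneg
    exact pow_le_pow_left₀ hθ.le (by nlinarith) 2
  · have : (0 : ℝ) ≤ (M - n : ℕ) := Nat.cast_nonneg _
    linarith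

/-- This is the slow descent: a squared ratio drops by at most 1 per step, so ½(b_{i+1}² − b_i²)
costs at most 1/2, whatever M is. -/
theorem capRatio_sq_sub (hβ : 0 < β) :
    -1 ≤ capRatio β θ M (n + 1) ^ 2 - capRatio β θ M n ^ 2 := by
  rw [capRatio_sq, capRatio_sq]
  have h1 : (((n : ℝ) + 1) * β) ^ 2 ≤ (((n + 1 : ℕ) + 1) * β) ^ 2 := by
    push_cast; gcongr; linarith
  have h2 : ((M - n : ℕ) : ℝ) ≤ (M - (n + 1) : ℕ) + 1 := by
    have : M - n ≤ M - (n + 1) + 1 := by omega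
    exact_mod_cast this
  have h3 := min_le_left (((n + 1 : ℝ) * β) ^ 2) (θ ^ 2 + (M - n : ℕ))
  have h4 := min_le_right (((n + 1 : ℝ) * β) ^ 2) (θ ^ 2 + (M - n : ℕ))
  have : min (((n + 1 : ℝ) * β) ^ 2) (θ ^ 2 + (M - n : ℕ)) - 1 ≤
      min ((((n + 1 : ℕ) + 1 : ℝ) * β) ^ 2) (θ ^ 2 + (M - (n + 1) : ℕ)) :=
    le_min (by linarith) (by linarith)
  linarith

theorem capRatio_of_le (hθ : 0 < θ) (hθβ : θ ≤ β) (h : M ≤ n) : capRatio β θ M n = θ := by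
  have h0 : M - n = 0 := by omega
  have hn : (0 : ℝ) ≤ n := n.cast_nonneg
  rw [capRatio, h0, Nat.cast_zero, add_zero, min_eq_right, Real.sqrt_sq hθ.le]
  exact pow_le_pow_left₀ hθ.le (by nlinarith) 2

theorem capWeight_succ : capWeight β θ M (n + 1) = capWeight β θ M n * capRatio β θ M n :=
  Finset.prod_range_succ _ _

theorem capWeight_pos (hθ : 0 < θ) (hθβ : θ ≤ β) : 0 < capWeight β θ M n :=
  Finset.prod_pos fun i _ => hθ.trans_le (le_capRatio M i hθ hθβ)

theorem capWeight_le (hβ : 0 < β) : capWeight β θ M n ≤ n.factorial * β ^ n := by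
  induction n with
  | zero => simp [capWeight]
  | succ n ih =>
    rw [capWeight_succ, Nat.factorial_succ]
    push_cast
    calc _ ≤ (n.factorial * β ^ n) * ((n + 1) * β) :=
          mul_le_mul ih (capRatio_le M n hβ) (Real.sqrt_nonneg _) (by positivity)
      _ = _ := by ring

theorem capWeight_eq_of_large (hβ : 0 < β) (h : (n * β) ^ 2 + n ≤ M) :
    capWeight β θ M n = n.factorial * β ^ n := by
  have hr : ∀ i ∈ Finset.range n, capRatio β θ M i = (i + 1) * β := by
    intro i hi
    rw [Finset.mem_range] at hi
    have hi' : (i : ℝ) + 1 ≤ n := by exact_mod_cast hi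
    have hMn : n ≤ M := by
      have : (n : ℝ) ≤ M := by nlinarith [sq_nonneg (n * β)]
      exact_mod_cast this
    have h1 : ((M - i : ℕ) : ℝ) = M - i := by rw [Nat.cast_sub (by omega)]
    rw [capRatio, min_eq_left, Real.sqrt_sq (by positivity)]
    rw [h1]
    have : (((i : ℝ) + 1) * β) ^ 2 ≤ (n * β) ^ 2 := by gcongr
    nlinarith [sq_nonneg θ]
  rw [capWeight, Finset.prod_congr rfl hr, Finset.prod_mul_distrib, Finset.prod_const,
    Finset.card_range]
  congr 1
  rw [← Finset.prod_range_add_one_eq_factorial]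
  push_cast
  rfl

/-- Past M the weight is geometric with ratio θ, hence summable against a bound T^{-n} with T > θ.
-/
theorem capWeight_add (hθ : 0 < θ) (hθβ : θ ≤ β) :
    capWeight β θ M (M + n) = capWeight β θ M M * θ ^ n := by
  induction n with
  | zero => simp
  | succ n ih =>
    rw [← add_assoc, capWeight_succ, ih, capRatio_of_le M _ hθ hθβ (by omega), pow_succ]
    ring

end Cap

/-- The factor e^{kt²} is common to all sites, so the differences of p vanish, while p' = 2k
outweighs the loss 1/2 from the descending ratios. -/
theorem isCarlemanWeight_cap {β θ : ℝ} (hβ : 0 < β) (hθ : 0 < θ) (hθβ : θ ≤ β) (M : ℕ) (k : ℝ) :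
    IsCarlemanWeight (2 * k - 1 / 2) θ (fun n t => Real.exp (k * t ^ 2) * capWeight β θ M n)
      (fun _ t => 2 * k * t) (fun _ _ => 2 * k) where
  pos n t := mul_pos (Real.exp_pos _) (capWeight_pos M n hθ hθβ)
  hasDerivAt n t := by
    have h := (((hasDerivAt_pow 2 t).const_mul k).exp).mul_const (capWeight β θ M n)
    refine h.congr_deriv ?_
    simp
    ring
  hasDerivAt_log n t := by simpa using (hasDerivAt_id t).const_mul (2 * k)
  ratio_ge n t _ := by
    rw [capWeight_succ]
    have h1 := le_capRatio M n hθ hθβ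
    have h2 := capWeight_pos M n hθ hθβ
    have h3 := Real.exp_pos (k * t ^ 2)
    nlinarith [mul_le_mul_of_nonneg_left h1 (mul_pos h3 h2).le]
  commutator_ge i t _ := by
    have hr : ∀ n, Real.exp (k * t ^ 2) * capWeight β θ M (n + 1)
        / (Real.exp (k * t ^ 2) * capWeight β θ M n) = capRatio β θ M n := fun n => by
      rw [capWeight_succ]
      have := (capWeight_pos M n hθ hθβ).ne'
      have := (Real.exp_pos (k * t ^ 2)).ne'
      field_simp
    simp only [show i + 2 = i + 1 + 1 from rfl, hr, sub_self, abs_zero, mul_zero]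
    have := capRatio_sq_sub (θ := θ) M i hβ
    linarith

/-- Factorial decay at both ends of the time interval persists inside, in the mean. -/
theorem IsLadder.interior_decay {A τ T β C M₀ : ℝ} {v v' : ℕ → ℝ → H} (hv : IsLadder A τ v v')
    (hT : 0 < T) (hβ : 0 < β)
    (hbound : ∀ n, ∀ t ∈ Set.Icc (0 : ℝ) 1, ‖v n t‖ ≤ M₀ / T ^ n)
    (h₀ : ∀ n : ℕ, n.factorial * (2 * β) ^ n * ‖v n 0‖ ≤ C)
    (h₁ : ∀ n : ℕ, n.factorial * (2 * β) ^ n * ‖v n 1‖ ≤ C) :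
    ∃ C₁ : ℝ, 0 ≤ C₁ ∧ ∀ n : ℕ, ∫ t in (0 : ℝ)..1,
      (((n + 1).factorial : ℝ) * β ^ (n + 1)) ^ 2 * ‖v (n + 1) t‖ ^ 2 ≤ C₁ := by
  have hM₀ : 0 ≤ M₀ := by
    have := (norm_nonneg _).trans (hbound 0 0 (by simp))
    simpa using this
  have hC : 0 ≤ C := by
    refine le_trans ?_ (h₀ 0)
    positivity
  -- With θ ≤ T/2 the weighted tail decays at least like 2^{-l}.
  set θ : ℝ := min β (T / 2) with hθdef
  have hθ : 0 < θ := lt_min hβ (by positivity)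
  have hθβ : θ ≤ β := min_le_left _ _
  have hθT : θ ≤ T / 2 := min_le_right _ _
  -- Chosen so that q − 3(A² + (τ/θ)²) = 1.
  set k : ℝ := (3 * (A ^ 2 + (τ / θ) ^ 2) + 3 / 2) / 2 with hk
  have hk0 : 0 < k := by positivity
  set P : ℝ := 2 * k + β
  set K : ℝ := Real.exp k * C
  have hP : 0 ≤ P := by positivity
  have hK : 0 ≤ K := by positivity
  set C₁ : ℝ := 4 * P * K ^ 2 + 3 * (Real.exp k * β) ^ 2 * M₀ ^ 2
  refine ⟨C₁, by positivity, fun n => ?_⟩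
  -- The cap starts late enough to leave the weight at site n + 1 purely factorial; the bound `C₁`
  -- was fixed independently of M.
  obtain ⟨M, hM⟩ := exists_nat_ge (((n + 1 : ℕ) * β) ^ 2 + (n + 1 : ℕ))
  have hexp : ∀ t ∈ Set.Icc (0 : ℝ) 1, Real.exp (k * t ^ 2) ≤ Real.exp k := fun t ht => by
    have : t ^ 2 ≤ 1 := pow_le_one₀ ht.1 ht.2
    exact Real.exp_le_exp.2 (by nlinarith)
  have hW := capWeight_eq_of_large (θ := θ) M (n + 1) hβ hM
  rw [← hW]
  have hbd : ∀ t ∈ Set.Icc (0 : ℝ) 1, (∀ n : ℕ, n.factorial * (2 * β) ^ n * ‖v n t‖ ≤ C) → ∀ N,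
      carlemanBoundary (fun n t => Real.exp (k * t ^ 2) * capWeight β θ M n)
        (fun _ t => 2 * k * t) v N t ≤ 2 * P * K ^ 2 := by
    intro t ht hdec N
    refine carlemanBoundary_le (fun n => (mul_pos (Real.exp_pos _)
      (capWeight_pos M n hθ hθβ)).le) hP hK (fun n => ?_) (fun n => ?_) (fun n => ?_) N
    · have hn : (0 : ℝ) ≤ n := n.cast_nonneg
      have ht0 := ht.1
      rw [abs_of_nonneg (by positivity)]
      calc 2 * k * t ≤ 2 * k * 1 := by gcongr; exact ht.2
        _ ≤ P * 1 := by simp only [P]; linarith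
        _ ≤ _ := by gcongr; linarith
    · rw [capWeight_succ]
      have h1 := capRatio_le (θ := θ) M n hβ
      have h2 := capWeight_pos (β := β) M n hθ hθβ
      have h3 : ((n : ℝ) + 1) * β ≤ P * (n + 1) := by
        rw [mul_comm]; gcongr; simp only [P]; linarith
      calc _ = capRatio β θ M n * (Real.exp (k * t ^ 2) * capWeight β θ M n) := by ring
        _ ≤ P * (n + 1) * (Real.exp (k * t ^ 2) * capWeight β θ M n) := by
          gcongr; exact h1.trans h3
    · calc Real.exp (k * t ^ 2) * capWeight β θ M n * ‖v n t‖
          ≤ Real.exp k * (n.factorial * β ^ n) * ‖v n t‖ := by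
            gcongr
            · exact (capWeight_pos M n hθ hθβ).le
            · exact Real.exp_le_exp.1 (hexp t ht)
            · exact capWeight_le M n hβ
        _ = Real.exp k * (n.factorial * (2 * β) ^ n * ‖v n t‖) * (1 / 2) ^ n := by
            rw [mul_pow, one_div, inv_pow]; field_simp
        _ ≤ Real.exp k * C * (1 / 2) ^ n := by gcongr; exact hdec n
  set Q : ℝ := Real.exp k ^ 2 * (capWeight β θ M M / T ^ M * M₀) ^ 2 with hQ
  have htail : ∀ l : ℕ, capWeight β θ M (M + l) / T ^ (M + l) * M₀ ≤
      capWeight β θ M M / T ^ M * M₀ * (1 / 2) ^ l := by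
    intro l
    rw [capWeight_add M l hθ hθβ]
    have h := capWeight_pos M M hθ hθβ
    calc _ = capWeight β θ M M / T ^ M * M₀ * (θ / T) ^ l := by
          rw [pow_add, div_pow]; field_simp
      _ ≤ _ := by
          have : θ / T ≤ 1 / 2 := by rw [div_le_iff₀ hT]; linarith
          gcongr ?_ * ?_ ^ _
  -- M stays fixed while the truncation level N = M + l goes to infinity.
  have hlim : ∀ l : ℕ, n ≤ l → ∫ t in (0 : ℝ)..1, capWeight β θ M (n + 1) ^ 2 * ‖v (n + 1) t‖ ^ 2
      ≤ C₁ + (3 * τ ^ 2 / T ^ 2 + T ^ 2) * Q * (1 / 4) ^ l := by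
    intro l hl
    set N := M + l
    have h1 := hv.carleman (isCarlemanWeight_cap hβ hθ hθβ M k) hθ N
      (fun t => capWeight β θ M (n + 1) ^ 2 * ‖v (n + 1) t‖ ^ 2
        - (3 * (Real.exp k * β) ^ 2 * M₀ ^ 2
          + (3 * τ ^ 2 / T ^ 2 + T ^ 2) * Q * (1 / 4) ^ l)) ?_ ?_
    · rw [intervalIntegral.integral_sub, intervalIntegral.integral_const] at h1
      · have h2 := hbd 0 (by simp) h₀ (N + 2)
        have h3 := hbd 1 (by simp) h₁ (N + 2)
        simp only [sub_zero, one_smul] at h1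
        simp only [C₁]
        linarith
      · refine ContinuousOn.intervalIntegrable ?_
        rw [Set.uIcc_of_le zero_le_one]
        exact continuousOn_const.mul ((hv.continuousOn _).norm.pow 2)
      · exact intervalIntegrable_const
    · exact (continuousOn_const.mul ((hv.continuousOn _).norm.pow 2)).sub continuousOn_const
    · intro t ht
      have htI : t ∈ Set.Icc (0 : ℝ) 1 := Set.Ioo_subset_Icc_self ht
      have hcoef : 2 * k - 1 / 2 - 3 * (A ^ 2 + (τ / θ) ^ 2) = 1 := by rw [hk]; ring
      rw [hcoef, one_mul]
      have hsum : capWeight β θ M (n + 1) ^ 2 * ‖v (n + 1) t‖ ^ 2 ≤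
          ∑ i ∈ Finset.range (N + 1),
            (Real.exp (k * t ^ 2) * capWeight β θ M (i + 1)) ^ 2 * ‖v (i + 1) t‖ ^ 2 := by
        refine le_trans ?_ (Finset.single_le_sum (f := fun i =>
          (Real.exp (k * t ^ 2) * capWeight β θ M (i + 1)) ^ 2 * ‖v (i + 1) t‖ ^ 2)
          (fun i _ => by positivity) (Finset.mem_range.2 (show n < N + 1 by omega)))
        have hone : 1 ≤ Real.exp (k * t ^ 2) := Real.one_le_exp (by positivity)
        have hpos := (capWeight_pos M (n + 1) hθ hθβ).le
        have : capWeight β θ M (n + 1) ≤ Real.exp (k * t ^ 2) * capWeight β θ M (n + 1) := by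
          nlinarith
        gcongr
      have he := hexp t htI
      have hbot : 3 * ((Real.exp (k * t ^ 2) * capWeight β θ M 1) ^ 2 * ‖v 0 t‖ ^ 2) ≤
          3 * (Real.exp k * β) ^ 2 * M₀ ^ 2 := by
        have h1 := capWeight_le (θ := θ) M 1 hβ
        have h2 := hbound 0 t htI
        have h3 := (capWeight_pos M 1 hθ hθβ).le
        simp only [Nat.factorial_one, Nat.cast_one, one_mul, pow_one, pow_zero, div_one] at h1 h2
        rw [mul_assoc]
        gcongr
      have hNl : capWeight β θ M (N + 1) / T ^ (N + 1) * M₀ ≤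
          capWeight β θ M M / T ^ M * M₀ * (1 / 2) ^ l := by
        refine (htail (l + 1)).trans ?_
        have := capWeight_pos M M hθ hθβ
        gcongr ?_ * ?_
        exact pow_le_pow_of_le_one (by norm_num) (by norm_num) (by omega)
      have hNl' : capWeight β θ M (N + 2) / T ^ (N + 2) * M₀ ≤
          capWeight β θ M M / T ^ M * M₀ * (1 / 2) ^ l := by
        refine (htail (l + 2)).trans ?_
        have := capWeight_pos M M hθ hθβ
        gcongr ?_ * ?_
        exact pow_le_pow_of_le_one (by norm_num) (by norm_num) (by omega)
      have hW1 := capWeight_pos M (N + 1) hθ hθβ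
      have hW2 := capWeight_pos M (N + 2) hθ hθβ
      have hsq : ((1 : ℝ) / 2) ^ l * (1 / 2) ^ l = (1 / 4) ^ l := by rw [← mul_pow]; norm_num
      have ht1 : (Real.exp (k * t ^ 2) * capWeight β θ M (N + 1)) ^ 2 * ‖v (N + 2) t‖ ^ 2 ≤
          1 / T ^ 2 * Q * (1 / 4) ^ l := by
        calc _ ≤ (Real.exp k * capWeight β θ M (N + 1)) ^ 2 * (M₀ / T ^ (N + 2)) ^ 2 := by
              gcongr; exact hbound _ t htI
          _ = 1 / T ^ 2 * (Real.exp k ^ 2 * (capWeight β θ M (N + 1) / T ^ (N + 1) * M₀) ^ 2) := by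
              rw [pow_succ T (N + 1)]; field_simp
          _ ≤ 1 / T ^ 2 * (Real.exp k ^ 2 *
                (capWeight β θ M M / T ^ M * M₀ * (1 / 2) ^ l) ^ 2) := by gcongr
          _ = _ := by rw [hQ, ← hsq]; ring
      have ht2 : (Real.exp (k * t ^ 2) * capWeight β θ M (N + 2)) ^ 2 * ‖v (N + 1) t‖ ^ 2 ≤
          T ^ 2 * Q * (1 / 4) ^ l := by
        calc _ ≤ (Real.exp k * capWeight β θ M (N + 2)) ^ 2 * (M₀ / T ^ (N + 1)) ^ 2 := by
              gcongr; exact hbound _ t htI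
          _ = T ^ 2 * (Real.exp k ^ 2 * (capWeight β θ M (N + 2) / T ^ (N + 2) * M₀) ^ 2) := by
              rw [pow_succ T (N + 1)]; field_simp
          _ ≤ T ^ 2 * (Real.exp k ^ 2 *
                (capWeight β θ M M / T ^ M * M₀ * (1 / 2) ^ l) ^ 2) := by gcongr
          _ = _ := by rw [hQ, ← hsq]; ring
      have ht1' := mul_le_mul_of_nonneg_left ht1 (show 0 ≤ 3 * τ ^ 2 by positivity)
      have : 3 * τ ^ 2 * (1 / T ^ 2 * Q * (1 / 4) ^ l) = 3 * τ ^ 2 / T ^ 2 * Q * (1 / 4) ^ l := by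
        ring
      linarith
  have htend : Filter.Tendsto
      (fun l : ℕ => C₁ + (3 * τ ^ 2 / T ^ 2 + T ^ 2) * Q * (1 / 4 : ℝ) ^ l)
      Filter.atTop (nhds (C₁ + (3 * τ ^ 2 / T ^ 2 + T ^ 2) * Q * 0)) :=
    ((tendsto_pow_atTop_nhds_zero_of_lt_one (by norm_num) (by norm_num)).const_mul _).const_add _
  rw [mul_zero, add_zero] at htend
  exact ge_of_tendsto htend (Filter.eventually_atTop.2 ⟨n, hlim⟩)

end InteriorDecay

/-! ### Vanishing at time 1/2 -/

section Midpoint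

variable {H : Type*} [NormedAddCommGroup H] [InnerProductSpace ℝ H]

theorem exp_three_ge : (20 : ℝ) ≤ Real.exp 3 := by
  have h := Real.exp_one_gt_d9
  have : Real.exp 3 = Real.exp 1 ^ 3 := by rw [← Real.exp_nat_mul]; norm_num
  rw [this]
  calc (20 : ℝ) ≤ 2.7182818283 ^ 3 := by norm_num
    _ ≤ _ := by gcongr

theorem exp_three_le : Real.exp 3 ≤ (32 : ℝ) := by
  have h := Real.exp_one_lt_d9
  have : Real.exp 3 = Real.exp 1 ^ 3 := by rw [← Real.exp_nat_mul]; norm_num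
  rw [this]
  calc Real.exp 1 ^ 3 ≤ 2.7182818286 ^ 3 := by gcongr
    _ ≤ _ := by norm_num

theorem exp_four_le : Real.exp 4 ≤ (56 : ℝ) := by
  have h := Real.exp_one_lt_d9
  have : Real.exp 4 = Real.exp 1 ^ 4 := by rw [← Real.exp_nat_mul]; norm_num
  rw [this]
  calc Real.exp 1 ^ 4 ≤ 2.7182818286 ^ 4 := by gcongr
    _ ≤ _ := by norm_num

/-- The factorial weight of shift `m`, which is largest at time `1 / 2`. -/
def bellWeight (m n : ℕ) (t : ℝ) : ℝ :=
  (n + m).factorial * Real.exp ((n + m) * (4 - 4 * (t - 1 / 2) ^ 2))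

theorem bellWeight_pos (m n : ℕ) (t : ℝ) : 0 < bellWeight m n t := by
  unfold bellWeight; positivity

theorem bellWeight_succ (m n : ℕ) (t : ℝ) :
    bellWeight m (n + 1) t =
      (n + m + 1) * Real.exp (4 - 4 * (t - 1 / 2) ^ 2) * bellWeight m n t := by
  unfold bellWeight
  rw [show n + 1 + m = n + m + 1 by ring, Nat.factorial_succ]
  push_cast
  rw [show ((n : ℝ) + 1 + m) * (4 - 4 * (t - 1 / 2) ^ 2) = (4 - 4 * (t - 1 / 2) ^ 2)
    + (n + m) * (4 - 4 * (t - 1 / 2) ^ 2) by ring, Real.exp_add]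
  ring

theorem isCarlemanWeight_bell (m : ℕ) :
    IsCarlemanWeight m 1 (bellWeight m) (fun n t => -8 * (n + m) * (t - 1 / 2))
      (fun n _ => -8 * (n + m)) where
  pos := bellWeight_pos m
  hasDerivAt n t := by
    have h1 : HasDerivAt (fun s : ℝ => s - 1 / 2) 1 t := (hasDerivAt_id t).sub_const _
    have h2 := ((((h1.pow 2).const_mul 4).const_sub 4).const_mul ((n : ℝ) + m)).exp.const_mul
      ((n + m).factorial : ℝ)
    refine h2.congr_deriv ?_
    simp [bellWeight]
    ring
  hasDerivAt_log n t := by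
    have h1 : HasDerivAt (fun s : ℝ => s - 1 / 2) 1 t := (hasDerivAt_id t).sub_const _
    simpa using h1.const_mul (-8 * ((n : ℝ) + m))
  ratio_ge n t ht := by
    rw [bellWeight_succ]
    have h1 := bellWeight_pos m n t
    have h2 : 1 ≤ Real.exp (4 - 4 * (t - 1 / 2) ^ 2) :=
      Real.one_le_exp (by nlinarith [ht.1, ht.2])
    have h3 : (1 : ℝ) ≤ n + m + 1 := by
      have := n.cast_nonneg (α := ℝ)
      have := m.cast_nonneg (α := ℝ)
      linarith
    gcongr
    nlinarith
  commutator_ge i t ht := by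
    have hr : ∀ n, bellWeight m (n + 1) t / bellWeight m n t =
        (n + m + 1) * Real.exp (4 - 4 * (t - 1 / 2) ^ 2) := fun n => by
      rw [bellWeight_succ, mul_div_cancel_right₀ _ (bellWeight_pos m n t).ne']
    have hρ : 20 ≤ Real.exp (4 - 4 * (t - 1 / 2) ^ 2) :=
      exp_three_ge.trans (Real.exp_le_exp.2 (by nlinarith [ht.1, ht.2]))
    set ρ := Real.exp (4 - 4 * (t - 1 / 2) ^ 2)
    have habs : |t - 1 / 2| ≤ 1 / 2 := by
      rw [abs_le]; constructor <;> linarith [ht.1, ht.2]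
    have hdiff : ∀ n : ℕ, |-8 * (((n + 1 : ℕ) : ℝ) + m) * (t - 1 / 2)
        - -8 * ((n : ℝ) + m) * (t - 1 / 2)| ≤ 4 := fun n => by
      rw [show -8 * (((n + 1 : ℕ) : ℝ) + m) * (t - 1 / 2) - -8 * ((n : ℝ) + m) * (t - 1 / 2)
        = -8 * (t - 1 / 2) by push_cast; ring, abs_mul]
      norm_num
      linarith
    simp only [show i + 2 = i + 1 + 1 from rfl, hr]
    have d1 := hdiff (i + 1)
    have d0 := hdiff i
    have hi := i.cast_nonneg (α := ℝ)
    have hm := m.cast_nonneg (α := ℝ)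
    set e1 := |-8 * (((i + 1 + 1 : ℕ) : ℝ) + m) * (t - 1 / 2)
        - -8 * (((i + 1 : ℕ) : ℝ) + m) * (t - 1 / 2)|
    set e0 := |-8 * (((i + 1 : ℕ) : ℝ) + m) * (t - 1 / 2) - -8 * ((i : ℝ) + m) * (t - 1 / 2)|
    push_cast
    have hl : 0 ≤ (i : ℝ) + m + 1 := by positivity
    have c1 : ((i : ℝ) + 1 + m + 1) * ρ * e1 ≤ ((i : ℝ) + 1 + m + 1) * ρ * 4 := by gcongr
    have c0 : ((i : ℝ) + m + 1) * ρ * e0 ≤ ((i : ℝ) + m + 1) * ρ * 4 := by gcongr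
    -- With L = i + m + 1 the commutator is at least (2L + 1)(ρ²/2 − 4ρ − 4): squared ratios,
    -- differences of p, and p' = −8L. At ρ = 20 the last factor is 200 − 80 − 4.
    have hquad : 116 ≤ ρ ^ 2 / 2 - 4 * ρ - 4 := by nlinarith
    have hfin := mul_le_mul_of_nonneg_left hquad (show 0 ≤ 2 * ((i : ℝ) + m + 1) + 1 by positivity)
    nlinarith

/-- Here 56 bounds e⁴, and a binomial coefficient is at most a power of 2, giving 112 = 128 · 7/8:
interior decay at rate 128 beats the bell weight with room 7/8. -/
theorem factorial_add_le (a m : ℕ) :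
    ((a + m).factorial : ℝ) * 56 ^ (a + m) ≤
      a.factorial * 128 ^ a * (m.factorial * 112 ^ m) * (7 / 8) ^ a := by
  have h1 : (a + m).factorial = (a + m).choose a * a.factorial * m.factorial := by
    have := Nat.choose_mul_factorial_mul_factorial (Nat.le_add_right a m)
    rw [Nat.add_sub_cancel_left] at this
    exact this.symm
  have h2 : ((a + m).choose a : ℝ) ≤ 2 ^ (a + m) := by
    exact_mod_cast Nat.choose_le_two_pow (a + m) a
  calc ((a + m).factorial : ℝ) * 56 ^ (a + m)
      = (a + m).choose a * (a.factorial * m.factorial * 56 ^ (a + m)) := by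
        rw [h1]; push_cast; ring
    _ ≤ 2 ^ (a + m) * (a.factorial * m.factorial * 56 ^ (a + m)) := by gcongr
    _ = a.factorial * m.factorial * (2 * 56) ^ (a + m) := by rw [mul_pow]; ring
    _ = a.factorial * (128 * (7 / 8)) ^ a * (m.factorial * 112 ^ m) := by
        norm_num
        rw [pow_add]; ring
    _ = _ := by rw [mul_pow]; ring

/-- One term of the expansion of (1/4 + 3/4)^{n+m}. The split is uneven because growth in m must
stay small: the endpoint bound (4/3 · e³)^{2m} has to lose to e^{7m}. -/
theorem factorial_add_le' (n m : ℕ) :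
    ((n + m).factorial : ℝ) ≤ n.factorial * 4 ^ n * (m.factorial * (4 / 3) ^ m) := by
  have h1 : (n + m).factorial = (n + m).choose n * n.factorial * m.factorial := by
    have := Nat.choose_mul_factorial_mul_factorial (Nat.le_add_right n m)
    rw [Nat.add_sub_cancel_left] at this
    exact this.symm
  have h2 : ((1 : ℝ) / 4) ^ n * (3 / 4) ^ m * (n + m).choose n ≤ 1 := by
    have h := add_pow (1 / 4 : ℝ) (3 / 4) (n + m)
    have h3 := Finset.single_le_sum (f := fun k => (1 / 4 : ℝ) ^ k * (3 / 4) ^ (n + m - k)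
      * (n + m).choose k) (fun k _ => by positivity)
      (Finset.mem_range.2 (show n < n + m + 1 by omega))
    rw [← h] at h3
    norm_num at h3 ⊢
    simpa using h3
  have h4 : ((n + m).choose n : ℝ) ≤ 4 ^ n * (4 / 3) ^ m := by
    have e1 : ((1 : ℝ) / 4) ^ n * 4 ^ n = 1 := by rw [← mul_pow]; norm_num
    have e2 : ((3 : ℝ) / 4) ^ m * (4 / 3) ^ m = 1 := by rw [← mul_pow]; norm_num
    calc ((n + m).choose n : ℝ)
        = (((1 : ℝ) / 4) ^ n * 4 ^ n) * ((3 / 4) ^ m * (4 / 3) ^ m) * (n + m).choose n := by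
          rw [e1, e2]; ring
      _ = (4 ^ n * (4 / 3) ^ m) * (((1 : ℝ) / 4) ^ n * (3 / 4) ^ m * (n + m).choose n) := by ring
      _ ≤ (4 ^ n * (4 / 3) ^ m) * 1 := by gcongr
      _ = _ := mul_one _
  rw [h1]
  push_cast
  calc ((n + m).choose n : ℝ) * n.factorial * m.factorial
      ≤ (4 ^ n * (4 / 3) ^ m) * n.factorial * m.factorial := by gcongr
    _ = _ := by ring

theorem bellWeight_le (m n : ℕ) (t : ℝ) :
    bellWeight m n t ≤ (n + m).factorial * 56 ^ (n + m) := by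
  unfold bellWeight
  have : Real.exp (((n : ℝ) + m) * (4 - 4 * (t - 1 / 2) ^ 2)) ≤ Real.exp 4 ^ (n + m) := by
    rw [← Real.exp_nat_mul]
    push_cast
    gcongr
    nlinarith [sq_nonneg (t - 1 / 2)]
  gcongr
  exact this.trans (by gcongr; exact exp_four_le)

theorem carlemanBoundary_bell_le {E : Type*} [NormedAddCommGroup E] {v : ℕ → ℝ → E} {C t : ℝ}
    (ht : (t - 1 / 2) ^ 2 = 1 / 4)
    (hC : 0 ≤ C) (hdec : ∀ n : ℕ, n.factorial * (2 * 128) ^ n * ‖v n t‖ ≤ C) (m N : ℕ) :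
    carlemanBoundary (bellWeight m) (fun n t => -8 * ((n : ℝ) + m) * (t - 1 / 2)) v N t ≤
      2 * (32 * (m + 1)) * (C * (m.factorial * (4 / 3 * Real.exp 3) ^ m)) ^ 2 := by
  have hρ : Real.exp (4 - 4 * (t - 1 / 2) ^ 2) = Real.exp 3 := by rw [ht]; norm_num
  have habs : |t - 1 / 2| = 1 / 2 := by
    rw [← Real.sqrt_sq_eq_abs, ht, show (1 : ℝ) / 4 = (1 / 2) ^ 2 by norm_num,
      Real.sqrt_sq (by norm_num)]
  have hm := m.cast_nonneg (α := ℝ)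
  refine carlemanBoundary_le (fun n => (bellWeight_pos m n t).le) (by positivity) (by positivity)
    (fun n => ?_) (fun n => ?_) (fun n => ?_) N
  · have hn := n.cast_nonneg (α := ℝ)
    rw [abs_mul, habs, abs_mul, abs_of_nonneg (show 0 ≤ (n : ℝ) + m by positivity)]
    norm_num
    nlinarith [mul_nonneg hn hm]
  · have hn := n.cast_nonneg (α := ℝ)
    rw [bellWeight_succ, hρ]
    have := bellWeight_pos m n t
    have h1 : ((n : ℝ) + m + 1) * Real.exp 3 ≤ (n + m + 1) * 32 := by
      gcongr; exact exp_three_le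
    refine mul_le_mul_of_nonneg_right ?_ this.le
    nlinarith [mul_nonneg hn hm]
  · have hw : bellWeight m n t = (n + m).factorial * Real.exp 3 ^ (n + m) := by
      rw [bellWeight, ← Real.exp_nat_mul, ht]; norm_num
    rw [hw]
    -- 4e³ ≤ 128, half of the assumed rate 256; the other half gives the geometric decay.
    have h1 : Real.exp 3 ^ n * 4 ^ n ≤ (2 * 128) ^ n * (1 / 2) ^ n := by
      rw [← mul_pow, ← mul_pow]
      exact pow_le_pow_left₀ (by positivity) (by linarith [exp_three_le]) n
    calc ((n + m).factorial : ℝ) * Real.exp 3 ^ (n + m) * ‖v n t‖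
        ≤ (n.factorial * 4 ^ n * (m.factorial * (4 / 3) ^ m)) * Real.exp 3 ^ (n + m) * ‖v n t‖ := by
          gcongr; exact factorial_add_le' n m
      _ = (n.factorial * ‖v n t‖ * (m.factorial * (4 / 3 * Real.exp 3) ^ m))
          * (Real.exp 3 ^ n * 4 ^ n) := by rw [mul_pow, pow_add]; ring
      _ ≤ (n.factorial * ‖v n t‖ * (m.factorial * (4 / 3 * Real.exp 3) ^ m))
          * ((2 * 128) ^ n * (1 / 2) ^ n) := by gcongr
      _ = (n.factorial * (2 * 128) ^ n * ‖v n t‖) * (m.factorial * (4 / 3 * Real.exp 3) ^ m)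
          * (1 / 2) ^ n := by ring
      _ ≤ _ := by gcongr; exact hdec n

variable {A τ T C M₀ : ℝ} {v v' : ℕ → ℝ → H}

/-- Interior decay at rate 128 makes the truncation errors O((49/64)^N), so N → ∞ leaves only the
v_0 error and the endpoint terms. -/
theorem IsLadder.carleman_bell (hv : IsLadder A τ v v') (hT : 0 < T)
    (hbound : ∀ n, ∀ t ∈ Set.Icc (0 : ℝ) 1, ‖v n t‖ ≤ M₀ / T ^ n)
    (h₀ : ∀ n : ℕ, n.factorial * (2 * 128) ^ n * ‖v n 0‖ ≤ C)
    (h₁ : ∀ n : ℕ, n.factorial * (2 * 128) ^ n * ‖v n 1‖ ≤ C) (m : ℕ)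
    (hm : 3 * (A ^ 2 + τ ^ 2) ≤ m) :
    ∫ t in (0 : ℝ)..1, bellWeight m 1 t ^ 2 *
      ((m - 3 * (A ^ 2 + τ ^ 2)) * ‖v 1 t‖ ^ 2 - 3 * ‖v 0 t‖ ^ 2) ≤
      128 * (m + 1) * (C * (m.factorial * (4 / 3 * Real.exp 3) ^ m)) ^ 2 := by
  have hC : 0 ≤ C := by
    refine le_trans ?_ (h₀ 0)
    positivity
  obtain ⟨C₁, hC₁, hdec⟩ := hv.interior_decay hT (by norm_num) hbound h₀ h₁
  have hvc := hv.continuousOn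
  have hint : ∀ n, IntervalIntegrable (fun t => ‖v n t‖ ^ 2) MeasureTheory.volume 0 1 := fun n => by
    refine ContinuousOn.intervalIntegrable ?_
    rw [Set.uIcc_of_le zero_le_one]
    exact (hvc n).norm.pow 2
  have hwc : Continuous (bellWeight m 1) := by unfold bellWeight; fun_prop
  set F : ℝ → ℝ := fun t => bellWeight m 1 t ^ 2 *
      ((m - 3 * (A ^ 2 + τ ^ 2)) * ‖v 1 t‖ ^ 2 - 3 * ‖v 0 t‖ ^ 2)
  have hF : ContinuousOn F (Set.Icc 0 1) :=
    (hwc.pow 2).continuousOn.mul ((continuousOn_const.mul ((hvc 1).norm.pow 2)).sub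
      (continuousOn_const.mul ((hvc 0).norm.pow 2)))
  set W : ℕ → ℝ := fun a => (a + m).factorial * 56 ^ (a + m)
  have hWpos : ∀ a, 0 ≤ W a := fun a => by positivity
  have hdecay : ∀ (n j : ℕ), (∫ t in (0 : ℝ)..1, ‖v (n + 1) t‖ ^ 2) *
      (((n + 1 + j).factorial : ℝ) * 56 ^ (n + 1 + j)) ^ 2 ≤
      C₁ * (j.factorial * 112 ^ j) ^ 2 * (49 / 64) ^ n := by
    intro n j
    have h1 := hdec n
    rw [intervalIntegral.integral_const_mul] at h1
    have hI : 0 ≤ ∫ t in (0 : ℝ)..1, ‖v (n + 1) t‖ ^ 2 :=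
      intervalIntegral.integral_nonneg zero_le_one fun t _ => by positivity
    calc _ ≤ (∫ t in (0 : ℝ)..1, ‖v (n + 1) t‖ ^ 2) * ((n + 1).factorial * 128 ^ (n + 1)
            * (j.factorial * 112 ^ j) * (7 / 8) ^ (n + 1)) ^ 2 := by
          gcongr ?_ * ?_ ^ 2
          exact factorial_add_le (n + 1) j
      _ = ((((n + 1).factorial : ℝ) * 128 ^ (n + 1)) ^ 2
            * ∫ t in (0 : ℝ)..1, ‖v (n + 1) t‖ ^ 2)
            * ((j.factorial * 112 ^ j) ^ 2 * ((7 / 8) ^ (n + 1)) ^ 2) := by ring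
      _ ≤ C₁ * ((j.factorial * 112 ^ j) ^ 2 * ((7 / 8) ^ n) ^ 2) := by
          gcongr ?_ * (_ * ?_ ^ 2)
          exact pow_le_pow_of_le_one (by norm_num) (by norm_num) (by omega)
      _ = _ := by
          rw [← pow_mul, mul_comm n 2, pow_mul]; norm_num; ring
  set Q : ℝ := 3 * τ ^ 2 * (C₁ * (m.factorial * 112 ^ m) ^ 2)
    + C₁ * ((m + 1).factorial * 112 ^ (m + 1)) ^ 2
  have hN : ∀ N : ℕ, ∫ t in (0 : ℝ)..1, F t ≤
      128 * (m + 1) * (C * (m.factorial * (4 / 3 * Real.exp 3) ^ m)) ^ 2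
        + Q * (49 / 64) ^ N := by
    intro N
    have h1 := hv.carleman (isCarlemanWeight_bell m) one_pos N
      (fun t => F t - (3 * τ ^ 2 * (W (N + 2)) ^ 2 * ‖v (N + 2) t‖ ^ 2
        + W (N + 2) ^ 2 * ‖v (N + 1) t‖ ^ 2)) ?_ ?_
    · rw [intervalIntegral.integral_sub, intervalIntegral.integral_add,
        intervalIntegral.integral_const_mul, intervalIntegral.integral_const_mul] at h1
      · have b0 := carlemanBoundary_bell_le (t := 0) (by norm_num) hC h₀ m (N + 2)
        have b1 := carlemanBoundary_bell_le (t := 1) (by norm_num) hC h₁ m (N + 2)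
        have d1 := mul_le_mul_of_nonneg_left (hdecay (N + 1) m)
          (show 0 ≤ 3 * τ ^ 2 by positivity)
        have d2 := hdecay N (m + 1)
        have hp : ((49 : ℝ) / 64) ^ (N + 1) ≤ (49 / 64) ^ N :=
          pow_le_pow_of_le_one (by norm_num) (by norm_num) (by omega)
        have d3 := mul_le_mul_of_nonneg_left hp (show
          0 ≤ 3 * τ ^ 2 * (C₁ * (m.factorial * 112 ^ m) ^ 2) by positivity)
        rw [show N + 1 + (m + 1) = N + 2 + m by ring] at d2
        simp only [show N + 1 + 1 = N + 2 from rfl] at d1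
        simp only [W, Q] at h1 ⊢
        linarith
      · exact (hint _).const_mul _
      · exact (hint _).const_mul _
      · refine ContinuousOn.intervalIntegrable ?_
        rwa [Set.uIcc_of_le zero_le_one]
      · exact ((hint _).const_mul _).add ((hint _).const_mul _)
    · exact hF.sub ((continuousOn_const.mul ((hvc _).norm.pow 2)).add
        (continuousOn_const.mul ((hvc _).norm.pow 2)))
    · intro t _
      have hsum : bellWeight m 1 t ^ 2 * ‖v 1 t‖ ^ 2 ≤
          ∑ i ∈ Finset.range (N + 1), bellWeight m (i + 1) t ^ 2 * ‖v (i + 1) t‖ ^ 2 :=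
        Finset.single_le_sum (f := fun i => bellWeight m (i + 1) t ^ 2 * ‖v (i + 1) t‖ ^ 2)
          (fun i _ => by positivity) (Finset.mem_range.2 (show 0 < N + 1 by omega))
      rw [div_one]
      have hsum' := mul_le_mul_of_nonneg_left hsum (sub_nonneg.2 hm)
      have hw2 : bellWeight m (N + 2) t ≤ W (N + 2) := bellWeight_le m (N + 2) t
      have hw1 : bellWeight m (N + 1) t ≤ W (N + 2) := by
        refine (bellWeight_le m (N + 1) t).trans ?_
        simp only [W]
        gcongr <;> first | omega | norm_num
      have t1 : 3 * τ ^ 2 * (bellWeight m (N + 1) t ^ 2 * ‖v (N + 2) t‖ ^ 2) ≤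
          3 * τ ^ 2 * W (N + 2) ^ 2 * ‖v (N + 2) t‖ ^ 2 := by
        rw [mul_assoc (3 * τ ^ 2)]
        have := (bellWeight_pos m (N + 1) t).le
        gcongr
      have t2 : bellWeight m (N + 2) t ^ 2 * ‖v (N + 1) t‖ ^ 2 ≤
          W (N + 2) ^ 2 * ‖v (N + 1) t‖ ^ 2 := by
        have := (bellWeight_pos m (N + 2) t).le
        gcongr
      simp only [F]
      linarith
  have htend : Filter.Tendsto
      (fun N : ℕ => 128 * (m + 1) * (C * (m.factorial * (4 / 3 * Real.exp 3) ^ m)) ^ 2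
        + Q * (49 / 64 : ℝ) ^ N) Filter.atTop
      (nhds (128 * (m + 1) * (C * (m.factorial * (4 / 3 * Real.exp 3) ^ m)) ^ 2 + Q * 0)) :=
    ((tendsto_pow_atTop_nhds_zero_of_lt_one (by norm_num) (by norm_num)).const_mul _).const_add _
  rw [mul_zero, add_zero] at htend
  exact ge_of_tendsto' htend hN

/-- A ladder with fast factorial decay at times `0` and `1` vanishes at time `1 / 2`. -/
theorem IsLadder.eq_zero_at_half (hv : IsLadder A τ v v') (hT : 0 < T)
    (hbound : ∀ n, ∀ t ∈ Set.Icc (0 : ℝ) 1, ‖v n t‖ ≤ M₀ / T ^ n)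
    (h₀ : ∀ n : ℕ, n.factorial * (2 * 128) ^ n * ‖v n 0‖ ≤ C)
    (h₁ : ∀ n : ℕ, n.factorial * (2 * 128) ^ n * ‖v n 1‖ ≤ C) :
    v 1 (1 / 2) = 0 := by
  by_contra hne
  have hvc := hv.continuousOn
  have hM₀ : ∀ t ∈ Set.Icc (0 : ℝ) 1, ‖v 0 t‖ ≤ M₀ := fun t ht => by simpa using hbound 0 t ht
  have ha : 0 < ‖v 1 (1 / 2)‖ ^ 2 := by positivity
  set a := ‖v 1 (1 / 2)‖ ^ 2 with ha_def
  obtain ⟨η, hη0, hη4, hη⟩ : ∃ η : ℝ, 0 < η ∧ η ≤ 1 / 4 ∧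
      ∀ t, |t - 1 / 2| ≤ η → a / 2 ≤ ‖v 1 t‖ ^ 2 := by
    have hcont : ContinuousAt (fun t => ‖v 1 t‖ ^ 2) (1 / 2) :=
      ((hvc 1).norm.pow 2).continuousAt (Icc_mem_nhds (by norm_num) (by norm_num))
    obtain ⟨ε, hε, hball⟩ := Metric.eventually_nhds_iff.1
      (hcont.eventually (lt_mem_nhds (show a / 2 < _ by simp only [← ha_def]; linarith)))
    refine ⟨min (ε / 2) (1 / 4), by positivity, min_le_right _ _, fun t ht => ?_⟩
    refine (hball ?_).le
    rw [Real.dist_eq]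
    have := ht.trans (min_le_left _ _)
    linarith
  set c₀ := 3 * (A ^ 2 + τ ^ 2)
  have hc₀ : 0 ≤ c₀ := by positivity
  -- The quotient makes the v_1 term dominate near 1/2: the window of length 2η then yields (3M₀² +
  -- 1)G, which beats the 3M₀²G lost to v_0. The term 2048 C² = 16 · 128 C² serves the final
  -- contradiction.
  obtain ⟨m, hm⟩ := exists_nat_gt
    (c₀ + (3 * M₀ ^ 2 + (3 * M₀ ^ 2 + 1) / (2 * η)) / (a / 2) + 2048 * C ^ 2 + 1)
  have hC2 := sq_nonneg C
  have hM2 := sq_nonneg M₀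
  have hfrac : 0 ≤ (3 * M₀ ^ 2 + (3 * M₀ ^ 2 + 1) / (2 * η)) / (a / 2) := by positivity
  have hmc : c₀ ≤ m := by linarith
  have hκ : 3 * M₀ ^ 2 + (3 * M₀ ^ 2 + 1) / (2 * η) ≤ (m - c₀) * (a / 2) := by
    rw [← div_le_iff₀ (by positivity)]; linarith
  have hmain := hv.carleman_bell hT hbound h₀ h₁ m hmc
  set s : ℝ := 2 * (m + 1)
  set G : ℝ := Real.exp (s * (4 - 4 * η ^ 2))
  have hG : 0 < G := Real.exp_pos _
  have hw : ∀ t, bellWeight m 1 t ^ 2 =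
      ((m + 1).factorial : ℝ) ^ 2 * Real.exp (s * (4 - 4 * (t - 1 / 2) ^ 2)) := fun t => by
    rw [bellWeight, mul_pow, ← Real.exp_nat_mul, add_comm 1 m]
    simp only [s]
    congr 2
    push_cast; ring
  -- Adding 3M₀²G makes the integrand nonnegative, so its integral is bounded below by the part over
  -- |t − 1/2| ≤ η.
  set f : ℝ → ℝ := fun t => Real.exp (s * (4 - 4 * (t - 1 / 2) ^ 2)) *
    ((m - c₀) * ‖v 1 t‖ ^ 2 - 3 * ‖v 0 t‖ ^ 2) + 3 * M₀ ^ 2 * G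
  have hfc : ContinuousOn f (Set.Icc 0 1) := by
    refine ContinuousOn.add (ContinuousOn.mul ?_ ((continuousOn_const.mul
      ((hvc 1).norm.pow 2)).sub (continuousOn_const.mul ((hvc 0).norm.pow 2)))) continuousOn_const
    exact Continuous.continuousOn (by fun_prop)
  have hfi : IntervalIntegrable f MeasureTheory.volume 0 1 := by
    refine ContinuousOn.intervalIntegrable ?_
    rwa [Set.uIcc_of_le zero_le_one]
  have hs : 0 < s := by positivity
  have hv0 : ∀ t ∈ Set.Icc (0 : ℝ) 1, ‖v 0 t‖ ^ 2 ≤ M₀ ^ 2 := fun t ht =>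
    pow_le_pow_left₀ (norm_nonneg _) (hM₀ t ht) 2
  have hnear : ∀ t, |t - 1 / 2| ≤ η → ((3 * M₀ ^ 2 + 1) / (2 * η)) * G ≤ f t := by
    intro t ht
    have htI : t ∈ Set.Icc (0 : ℝ) 1 := by
      rw [abs_le] at ht; constructor <;> linarith
    have h1 : G ≤ Real.exp (s * (4 - 4 * (t - 1 / 2) ^ 2)) := by
      refine Real.exp_le_exp.2 ?_
      have : (t - 1 / 2) ^ 2 ≤ η ^ 2 := by rw [← sq_abs]; gcongr
      gcongr
    have h2 : (3 * M₀ ^ 2 + 1) / (2 * η) ≤ (m - c₀) * ‖v 1 t‖ ^ 2 - 3 * ‖v 0 t‖ ^ 2 := by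
      have := mul_le_mul_of_nonneg_left (hη t ht) (sub_nonneg.2 hmc)
      linarith [hv0 t htI]
    have h3 : 0 ≤ (3 * M₀ ^ 2 + 1) / (2 * η) := by positivity
    calc _ = G * ((3 * M₀ ^ 2 + 1) / (2 * η)) := mul_comm _ _
      _ ≤ Real.exp (s * (4 - 4 * (t - 1 / 2) ^ 2)) *
          ((m - c₀) * ‖v 1 t‖ ^ 2 - 3 * ‖v 0 t‖ ^ 2) := by gcongr
      _ ≤ f t := by simp only [f]; linarith [mul_nonneg hM2 hG.le]
  have hnonneg : ∀ t ∈ Set.Icc (0 : ℝ) 1, 0 ≤ f t := by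
    intro t htI
    by_cases ht : |t - 1 / 2| ≤ η
    · exact le_trans (by positivity) (hnear t ht)
    · have h1 : Real.exp (s * (4 - 4 * (t - 1 / 2) ^ 2)) ≤ G := by
        refine Real.exp_le_exp.2 ?_
        have : η ^ 2 ≤ (t - 1 / 2) ^ 2 := by
          rw [← sq_abs (t - 1 / 2)]; push Not at ht; gcongr
        gcongr
      have h2 : -(3 * M₀ ^ 2) ≤ (m - c₀) * ‖v 1 t‖ ^ 2 - 3 * ‖v 0 t‖ ^ 2 := by
        have := mul_nonneg (sub_nonneg.2 hmc) (sq_nonneg ‖v 1 t‖)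
        linarith [hv0 t htI]
      have h3 := mul_le_mul_of_nonneg_left h2 (Real.exp_pos (s * (4 - 4 * (t - 1 / 2) ^ 2))).le
      have h4 := mul_le_mul_of_nonneg_left h1 (show 0 ≤ 3 * M₀ ^ 2 by positivity)
      simp only [f]
      linarith
  have hlow : (3 * M₀ ^ 2 + 1) * G ≤ ∫ t in (0 : ℝ)..1, f t := by
    have h1 : ∫ t in (1 / 2 - η)..(1 / 2 + η), f t ≤ ∫ t in (0 : ℝ)..1, f t := by
      refine intervalIntegral.integral_mono_interval (by linarith) (by linarith) (by linarith)
        ?_ hfi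
      refine (MeasureTheory.ae_restrict_iff' measurableSet_Ioc).2 (Filter.Eventually.of_forall ?_)
      exact fun t ht => hnonneg t (Set.Ioc_subset_Icc_self ht)
    have h2 : ∫ _ in (1 / 2 - η)..(1 / 2 + η), ((3 * M₀ ^ 2 + 1) / (2 * η)) * G ≤
        ∫ t in (1 / 2 - η)..(1 / 2 + η), f t := by
      refine intervalIntegral.integral_mono_on (by linarith) intervalIntegrable_const
        (hfi.mono_set ?_) fun t ht => hnear t ?_
      · rw [Set.uIcc_of_le zero_le_one, Set.uIcc_of_le (by linarith)]
        exact Set.Icc_subset_Icc (by linarith) (by linarith)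
      · rw [abs_le]; constructor <;> linarith [ht.1, ht.2]
    rw [intervalIntegral.integral_const, smul_eq_mul] at h2
    have h3 : (1 / 2 + η - (1 / 2 - η)) * ((3 * M₀ ^ 2 + 1) / (2 * η) * G)
        = (3 * M₀ ^ 2 + 1) * G := by field_simp; ring
    linarith
  have hsplit : ∫ t in (0 : ℝ)..1, bellWeight m 1 t ^ 2 *
      ((m - c₀) * ‖v 1 t‖ ^ 2 - 3 * ‖v 0 t‖ ^ 2)
      = ((m + 1).factorial : ℝ) ^ 2 * ((∫ t in (0 : ℝ)..1, f t) - 3 * M₀ ^ 2 * G) := by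
    have h1 : (∫ t in (0 : ℝ)..1, f t) - 3 * M₀ ^ 2 * G
        = ∫ t in (0 : ℝ)..1, (f t - 3 * M₀ ^ 2 * G) := by
      rw [intervalIntegral.integral_sub hfi intervalIntegrable_const,
        intervalIntegral.integral_const]
      simp
    rw [h1, ← intervalIntegral.integral_const_mul]
    refine intervalIntegral.integral_congr fun t _ => ?_
    simp only [f, hw]
    ring
  have hGle : G ≤ 128 * (m + 1) * (C * (4 / 3 * Real.exp 3) ^ m) ^ 2 := by
    have h1 : ((m + 1).factorial : ℝ) ^ 2 * G ≤
        ((m + 1).factorial : ℝ) ^ 2 * ((∫ t in (0 : ℝ)..1, f t) - 3 * M₀ ^ 2 * G) := by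
      gcongr; linarith
    rw [← hsplit] at h1
    have h2 : (m.factorial : ℝ) ≤ (m + 1).factorial := by
      exact_mod_cast Nat.factorial_le (by omega)
    have h3 : 128 * (m + 1) * (C * (m.factorial * (4 / 3 * Real.exp 3) ^ m)) ^ 2 ≤
        ((m + 1).factorial : ℝ) ^ 2 * (128 * (m + 1) * (C * (4 / 3 * Real.exp 3) ^ m) ^ 2) := by
      calc _ = (m.factorial : ℝ) ^ 2 * (128 * (m + 1) * (C * (4 / 3 * Real.exp 3) ^ m) ^ 2) := by
            ring
        _ ≤ _ := by gcongr
    exact le_of_mul_le_mul_left ((h1.trans hmain).trans h3) (by positivity)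
  have hm0 : (0 : ℝ) ≤ m := m.cast_nonneg
  -- Since η ≤ 1/4, G ≥ e^{15(m+1)/2}, which leaves e^{m/2} beyond e^{7m}.
  have hGge : Real.exp (m / 2) * Real.exp 7 ^ m ≤ G := by
    rw [← Real.exp_nat_mul, ← Real.exp_add]
    refine Real.exp_le_exp.2 ?_
    have hη2 : 4 * η ^ 2 ≤ 1 / 4 := by nlinarith
    simp only [s]
    nlinarith [mul_le_mul_of_nonneg_left hη2 (show (0 : ℝ) ≤ m + 1 by positivity)]
  -- Amounts to 16/9 ≤ e.
  have hpow : (C * (4 / 3 * Real.exp 3) ^ m) ^ 2 ≤ C ^ 2 * Real.exp 7 ^ m := by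
    rw [mul_pow, ← pow_mul, mul_comm m 2, pow_mul]
    gcongr
    have h7 : Real.exp 7 = Real.exp 1 * Real.exp 3 ^ 2 := by
      rw [← Real.exp_nat_mul, ← Real.exp_add]; norm_num
    rw [h7, mul_pow]
    gcongr
    linarith [Real.exp_one_gt_d9]
  have hfin : Real.exp (m / 2) ≤ 128 * (m + 1) * C ^ 2 := by
    have h7 : 0 < Real.exp 7 ^ m := by positivity
    refine le_of_mul_le_mul_right ?_ h7
    calc _ ≤ G := hGge
      _ ≤ _ := hGle
      _ ≤ 128 * (m + 1) * (C ^ 2 * Real.exp 7 ^ m) := by gcongr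
      _ = _ := by ring
  have hquad := Real.quadratic_le_exp_of_nonneg (x := (m : ℝ) / 2) (by positivity)
  have hm1 : 2048 * C ^ 2 + 1 < m := by linarith
  nlinarith

end Midpoint

/-! ### Lower bounds for Macdonald's function -/

section Macdonald

theorem macdonaldK_integrableOn (ν : ℝ) {z : ℝ} (hz : 0 < z) :
    MeasureTheory.IntegrableOn (fun s : ℝ => Real.exp (-z * Real.cosh s) * Real.cosh (ν * s))
      (Set.Ioi 0) := by
  refine integrable_of_isBigO_exp_neg (b := 1) one_pos (by fun_prop) ?_
  refine Asymptotics.IsBigO.of_bound (Real.exp ((|ν| + 1) ^ 2 / z)) ?_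
  filter_upwards [Filter.eventually_ge_atTop (0 : ℝ)] with s hs
  rw [Real.norm_of_nonneg (by positivity), Real.norm_of_nonneg (by positivity)]
  have h1 : Real.cosh (ν * s) ≤ Real.exp (|ν| * s) := by
    rw [Real.cosh_eq]
    have ha : Real.exp (ν * s) ≤ Real.exp (|ν| * s) :=
      Real.exp_le_exp.2 (mul_le_mul_of_nonneg_right (le_abs_self ν) hs)
    have hb : Real.exp (-(ν * s)) ≤ Real.exp (|ν| * s) := by
      rw [← neg_mul]
      exact Real.exp_le_exp.2 (mul_le_mul_of_nonneg_right (neg_le_abs ν) hs)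
    linarith
  have h2 : s ^ 2 / 4 ≤ Real.cosh s := by
    have ha := Real.quadratic_le_exp_of_nonneg hs
    have hb := Real.exp_pos (-s)
    rw [Real.cosh_eq]
    linarith
  calc Real.exp (-z * Real.cosh s) * Real.cosh (ν * s)
      ≤ Real.exp (-z * Real.cosh s) * Real.exp (|ν| * s) := by gcongr
    _ = Real.exp (-z * Real.cosh s + |ν| * s) := by rw [Real.exp_add]
    _ ≤ Real.exp ((|ν| + 1) ^ 2 / z + -1 * s) := by
        refine Real.exp_le_exp.2 ?_
        have h3 : z * (s ^ 2 / 4) ≤ z * Real.cosh s := by gcongr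
        have h4 : (|ν| + 1) * s ≤ (|ν| + 1) ^ 2 / z + z * (s ^ 2 / 4) := by
          have : (|ν| + 1) ^ 2 / z + z * (s ^ 2 / 4) - (|ν| + 1) * s
              = ((|ν| + 1) - z * s / 2) ^ 2 / z := by field_simp; ring
          have h5 : 0 ≤ ((|ν| + 1) - z * s / 2) ^ 2 / z := by positivity
          linarith
        linarith
    _ = _ := by rw [Real.exp_add]

theorem macdonaldK_le_of_abs_le {ν ν' z : ℝ} (hz : 0 < z) (h : |ν| ≤ |ν'|) :
    macdonaldK ν z ≤ macdonaldK ν' z := by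
  refine MeasureTheory.setIntegral_mono_on (macdonaldK_integrableOn ν hz)
    (macdonaldK_integrableOn ν' hz) measurableSet_Ioi fun s _ => ?_
  gcongr
  rw [Real.cosh_le_cosh, abs_mul, abs_mul]
  gcongr

/-- Keep only the unit interval starting at s₀ = log(ν/z + 1), close to where νs − z cosh s is
largest. There e^{νs} ≥ (ν/z + 1)^ν, and z cosh s ≤ 3(ν + z) because e < 3. -/
theorem macdonaldK_ge {ν z : ℝ} (hν : 0 ≤ ν) (hz : 0 < z) :
    1 / 2 * Real.exp (-(3 * z)) * Real.exp (-(3 * ν)) * (ν / z + 1) ^ ν ≤ macdonaldK ν z := by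
  have hy : 1 ≤ ν / z + 1 := by
    have : 0 ≤ ν / z := by positivity
    linarith
  have hy0 : 0 < ν / z + 1 := by linarith
  set s₀ := Real.log (ν / z + 1) with hs₀
  have hs0 : 0 ≤ s₀ := Real.log_nonneg hy
  set c := 1 / 2 * Real.exp (-(3 * z)) * Real.exp (-(3 * ν)) * (ν / z + 1) ^ ν
  have hsub : Set.Ioc s₀ (s₀ + 1) ⊆ Set.Ioi 0 := fun s hs => lt_of_le_of_lt hs0 hs.1
  have hconst : c = ∫ _ in Set.Ioc s₀ (s₀ + 1), c := by simp
  rw [hconst]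
  refine le_trans ?_ (MeasureTheory.setIntegral_mono_set (macdonaldK_integrableOn ν hz)
    (Filter.Eventually.of_forall fun s => by positivity) hsub.eventuallyLE)
  refine MeasureTheory.setIntegral_mono_on (by simp)
    ((macdonaldK_integrableOn ν hz).mono_set hsub) measurableSet_Ioc fun s hs => ?_
  have hspos : 0 < s := hsub hs
  have h1 : Real.cosh s ≤ 3 * (ν / z + 1) := by
    have hexp : Real.exp s ≤ Real.exp s₀ * Real.exp 1 := by
      rw [← Real.exp_add]; exact Real.exp_le_exp.2 hs.2
    rw [hs₀, Real.exp_log hy0] at hexp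
    have hn : Real.exp (-s) ≤ Real.exp s := Real.exp_le_exp.2 (by linarith)
    rw [Real.cosh_eq]
    have : (ν / z + 1) * Real.exp 1 ≤ (ν / z + 1) * 3 := by
      gcongr; linarith [Real.exp_one_lt_d9]
    linarith
  have h2 : 1 / 2 * (ν / z + 1) ^ ν ≤ Real.cosh (ν * s) := by
    rw [Real.rpow_def_of_pos hy0, Real.cosh_eq]
    have ha : Real.exp (Real.log (ν / z + 1) * ν) ≤ Real.exp (ν * s) := by
      refine Real.exp_le_exp.2 ?_
      rw [mul_comm]
      exact mul_le_mul_of_nonneg_left hs.1.le hν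
    linarith [Real.exp_pos (-(ν * s))]
  have h3 : Real.exp (-(3 * z)) * Real.exp (-(3 * ν)) ≤ Real.exp (-z * Real.cosh s) := by
    rw [← Real.exp_add]
    refine Real.exp_le_exp.2 ?_
    have := mul_le_mul_of_nonneg_left h1 hz.le
    have e : z * (3 * (ν / z + 1)) = 3 * ν + 3 * z := by field_simp
    linarith
  calc c = (Real.exp (-(3 * z)) * Real.exp (-(3 * ν))) * (1 / 2 * (ν / z + 1) ^ ν) := by
        simp only [c]; ring
    _ ≤ _ := by gcongr

theorem macdonaldK_pos (ν : ℝ) {z : ℝ} (hz : 0 < z) : 0 < macdonaldK ν z := by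
  have h := macdonaldK_ge le_rfl hz
  have h' := macdonaldK_le_of_abs_le (ν := 0) (ν' := ν) hz (by simp)
  refine lt_of_lt_of_le ?_ (h.trans h')
  positivity

theorem one_le_macdonaldK_div (ν : ℝ) {z : ℝ} (hz : 0 < z) :
    1 ≤ macdonaldK ν z / macdonaldK 0 z := by
  rw [one_le_div (macdonaldK_pos 0 hz)]
  exact macdonaldK_le_of_abs_le hz (by simp)

theorem macdonaldK_natCast_ge (k : ℕ) {z : ℝ} (hz : 0 < z) :
    1 / 2 * Real.exp (-(3 * z)) * (k.factorial / (z * Real.exp 3) ^ k) ≤ macdonaldK k z := by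
  refine le_trans ?_ (macdonaldK_ge k.cast_nonneg hz)
  rw [Real.rpow_natCast, mul_assoc (1 / 2 * _)]
  gcongr
  have h1 : (k.factorial : ℝ) ≤ k ^ k := by exact_mod_cast Nat.factorial_le_pow k
  have h2 : Real.exp (-(3 * (k : ℝ))) = (Real.exp 3 ^ k)⁻¹ := by
    rw [← Real.exp_nat_mul, Real.exp_neg, mul_comm]
  rw [h2]
  calc (k.factorial : ℝ) / (z * Real.exp 3) ^ k ≤ k ^ k / (z * Real.exp 3) ^ k := by gcongr
    _ = (Real.exp 3 ^ k)⁻¹ * (k / z) ^ k := by rw [mul_pow, div_pow]; field_simp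
    _ ≤ _ := by gcongr; linarith

end Macdonald

/-! ### Bounded operators and slices on the lattice -/

section LatticeOperators

theorem lp_two_norm_sq {α : Type*} (f : lp (fun _ : α => ℝ) 2) : ‖f‖ ^ 2 = ∑' i, f i ^ 2 := by
  have h := lp.norm_rpow_eq_tsum (p := 2) (by norm_num) f
  simpa using h

theorem lp_two_summable_sq {α : Type*} (f : lp (fun _ : α => ℝ) 2) :
    Summable fun i => f i ^ 2 := by
  have h := (lp.memℓp f).summable (by norm_num)
  simpa using h

theorem lp_two_norm_le_mul {α : Type*} {f g : lp (fun _ : α => ℝ) 2} {A : ℝ} (hA : 0 ≤ A)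
    (h : ∀ i, |g i| ≤ A * |f i|) : ‖g‖ ≤ A * ‖f‖ := by
  refine le_of_sq_le_sq ?_ (by positivity)
  rw [mul_pow, lp_two_norm_sq, lp_two_norm_sq, ← tsum_mul_left]
  refine (lp_two_summable_sq g).tsum_le_tsum (fun i => ?_) ((lp_two_summable_sq f).mul_left _)
  rw [← sq_abs (g i), ← sq_abs (f i), ← mul_pow]
  exact pow_le_pow_left₀ (abs_nonneg _) (h i) 2

/-- Restriction of square summable functions along an injective map. -/
def lpRestrict {α β : Type*} (e : α → β) (he : Function.Injective e) :
    lp (fun _ : β => ℝ) 2 →L[ℝ] lp (fun _ : α => ℝ) 2 :=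
  LinearMap.mkContinuous
    { toFun := fun f => ⟨fun i => f (e i), memℓp_gen (by
        simpa [Function.comp_def] using (lp_two_summable_sq f).comp_injective he)⟩
      map_add' := fun f g => rfl
      map_smul' := fun c f => rfl } 1 (fun f => by
      refine le_of_sq_le_sq ?_ (by positivity)
      rw [one_mul, lp_two_norm_sq, lp_two_norm_sq]
      exact tsum_comp_le_tsum_of_inj (lp_two_summable_sq f) (fun i => sq_nonneg _) he)

theorem norm_lpRestrict_apply_le {α β : Type*} (e : α → β) (he : Function.Injective e)
    (f : lp (fun _ : β => ℝ) 2) : ‖lpRestrict e he f‖ ≤ ‖f‖ := by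
  refine ((lpRestrict e he).le_opNorm f).trans ?_
  have h' : ‖lpRestrict e he‖ ≤ 1 := LinearMap.mkContinuous_norm_le _ zero_le_one _
  nlinarith [norm_nonneg f]

/-- The discrete Laplacian as a bounded operator on square summable functions. -/
def latticeLaplacian (d : ℕ) (h : ℝ) : LatticeL2 d →L[ℝ] LatticeL2 d :=
  (1 / h ^ 2) • ∑ k : Fin d,
    (lpRestrict (fun j : Fin d → ℤ => j + Pi.single k 1) (add_left_injective _)
      - (2 : ℝ) • ContinuousLinearMap.id ℝ _
      + lpRestrict (fun j : Fin d → ℤ => j - Pi.single k 1) (sub_left_injective))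

theorem latticeLaplacian_apply (d : ℕ) (h : ℝ) (f : LatticeL2 d) (j : Fin d → ℤ) :
    latticeLaplacian d h f j = discreteLaplacian h f j := by
  simp only [latticeLaplacian, discreteLaplacian, smul_apply,
    sum_apply, lp.coeFn_smul, Pi.smul_apply, smul_eq_mul, lp.coeFn_sum,
    Finset.sum_apply]
  rfl

/-- The slice of a function on `ℤ^{n+1}` at first coordinate `i`. -/
def latticeSlice (n : ℕ) (i : ℤ) : LatticeL2 (n + 1) →L[ℝ] LatticeL2 n :=
  lpRestrict (fun j : Fin n → ℤ => (Fin.cons i j : Fin (n + 1) → ℤ))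
    (Fin.cons_right_injective (α := fun _ => ℤ) i)

theorem latticeSlice_apply (n : ℕ) (i : ℤ) (f : LatticeL2 (n + 1)) (j : Fin n → ℤ) :
    latticeSlice n i f j = f (Fin.cons i j) := rfl

/-- Neighbours in the first direction are the adjacent slices; all other directions act within a
slice, as a bounded operator for fixed h. -/
theorem latticeSlice_laplacian (n : ℕ) (h : ℝ) (i : ℤ) (f : LatticeL2 (n + 1)) :
    latticeSlice n i (latticeLaplacian (n + 1) h f) =
      (1 / h ^ 2) • latticeSlice n (i - 1) f + (1 / h ^ 2) • latticeSlice n (i + 1) f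
        + (latticeLaplacian n h (latticeSlice n i f) - (2 / h ^ 2) • latticeSlice n i f) := by
  ext j
  have e1 : (Fin.cons i j : Fin (n + 1) → ℤ) + Pi.single 0 1 = Fin.cons (i + 1) j := by
    ext k; refine Fin.cases ?_ (fun k => ?_) k <;> simp
  have e2 : (Fin.cons i j : Fin (n + 1) → ℤ) - Pi.single 0 1 = Fin.cons (i - 1) j := by
    ext k; refine Fin.cases ?_ (fun k => ?_) k <;> simp
  have e3 : ∀ k : Fin n, (Fin.cons i j : Fin (n + 1) → ℤ) + Pi.single k.succ 1
      = Fin.cons i (j + Pi.single k 1) := fun k => by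
    ext l; refine Fin.cases ?_ (fun l => ?_) l <;> simp [Pi.single_apply, Fin.succ_inj]
  have e4 : ∀ k : Fin n, (Fin.cons i j : Fin (n + 1) → ℤ) - Pi.single k.succ 1
      = Fin.cons i (j - Pi.single k 1) := fun k => by
    ext l; refine Fin.cases ?_ (fun l => ?_) l <;> simp [Pi.single_apply, Fin.succ_inj]
  rw [latticeSlice_apply, latticeLaplacian_apply]
  simp only [lp.coeFn_add, lp.coeFn_sub, lp.coeFn_smul, Pi.add_apply, Pi.sub_apply, Pi.smul_apply,
    smul_eq_mul, latticeLaplacian_apply, discreteLaplacian, latticeSlice_apply, Fin.sum_univ_succ,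
    e1, e2, e3, e4]
  ring

end LatticeOperators

/-! ### The heat equation as an ODE in ℓ² -/

section HeatEquation

variable {d : ℕ} {h : ℝ} {V : (Fin d → ℤ) → ℝ → ℝ} {u : ℝ → LatticeL2 d}

theorem IsHeatSolution.continuousOn (hu : IsHeatSolution h V u) :
    ContinuousOn u (Set.Icc 0 1) := hu.contDiffOn.continuousOn

theorem IsHeatSolution.hasDerivAt (hu : IsHeatSolution h V u) {t : ℝ}
    (ht : t ∈ Set.Ioo (0 : ℝ) 1) : HasDerivAt u (deriv u t) t :=
  ((hu.contDiffOn.differentiableOn one_ne_zero t (Set.Ioo_subset_Icc_self ht)).differentiableAt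
    (Icc_mem_nhds ht.1 ht.2)).hasDerivAt

theorem IsHeatSolution.deriv_apply (hu : IsHeatSolution h V u) {t : ℝ}
    (ht : t ∈ Set.Ioo (0 : ℝ) 1) (j : Fin d → ℤ) :
    (deriv u t - latticeLaplacian d h (u t)) j = V j t * u t j := by
  have h1 : HasDerivAt (fun s => u s j) ((deriv u t) j) t :=
    (lp.evalCLM ℝ (fun _ : Fin d → ℤ => ℝ) 2 j).hasFDerivAt.comp_hasDerivAt t (hu.hasDerivAt ht)
  have h2 := h1.unique (hu.equation t ht j)
  rw [lp.coeFn_sub, Pi.sub_apply, h2, latticeLaplacian_apply]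
  ring

theorem abs_le_of_potentialNorm_lt_top (hV : potentialNorm V < ⊤) (j : Fin d → ℤ) {t : ℝ}
    (ht : t ∈ Set.Icc (0 : ℝ) 1) : |V j t| ≤ (potentialNorm V).toReal := by
  refine (ENNReal.ofReal_le_iff_le_toReal hV.ne).1 ?_
  exact le_iSup_of_le (f := fun j => ⨆ t ∈ Set.Icc (0 : ℝ) 1, ENNReal.ofReal |V j t|) j
    (le_iSup₂_of_le (f := fun t (_ : t ∈ Set.Icc (0 : ℝ) 1) => ENNReal.ofReal |V j t|) t ht le_rfl)

/-- Unique continuation in time, in both directions. -/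
theorem IsHeatSolution.eq_zero_of_half (hu : IsHeatSolution h V u) (hV : potentialNorm V < ⊤)
    (hhalf : u (1 / 2) = 0) : ∀ t ∈ Set.Icc (0 : ℝ) 1, u t = 0 := by
  set A := (potentialNorm V).toReal
  -- The generator is bounded, so Gronwall applies backward in time as well as forward.
  set K := ‖latticeLaplacian d h‖ + A
  have hbound : ∀ t ∈ Set.Ioo (0 : ℝ) 1, ‖deriv u t‖ ≤ K * ‖u t‖ := by
    intro t ht
    have h1 : ‖deriv u t - latticeLaplacian d h (u t)‖ ≤ A * ‖u t‖ := by
      refine lp_two_norm_le_mul ENNReal.toReal_nonneg fun j => ?_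
      rw [hu.deriv_apply ht, abs_mul]
      gcongr
      exact abs_le_of_potentialNorm_lt_top hV j (Set.Ioo_subset_Icc_self ht)
    have h2 := (latticeLaplacian d h).le_opNorm (u t)
    have h3 : ‖deriv u t‖ ≤ ‖deriv u t - latticeLaplacian d h (u t)‖
        + ‖latticeLaplacian d h (u t)‖ := by
      simpa using norm_add_le (deriv u t - latticeLaplacian d h (u t)) (latticeLaplacian d h (u t))
    simp only [K]
    linarith
  have hfwd : ∀ t ∈ Set.Icc (1 / 2 : ℝ) 1, u t = 0 := by
    refine eq_zero_of_abs_deriv_le_mul_abs_self_of_eq_zero_right (K := K) (f' := deriv u)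
      (hu.continuousOn.mono (Set.Icc_subset_Icc (by norm_num) le_rfl)) (fun t ht => ?_) hhalf
      (fun t ht => ?_)
    · exact (hu.hasDerivAt ⟨by linarith [ht.1], ht.2⟩).hasDerivWithinAt
    · exact hbound t ⟨by linarith [ht.1], ht.2⟩
  have hbwd : ∀ t ∈ Set.Icc (1 / 2 : ℝ) 1, u (1 - t) = 0 := by
    refine eq_zero_of_abs_deriv_le_mul_abs_self_of_eq_zero_right (K := K)
      (f := fun t => u (1 - t)) (f' := fun t => -deriv u (1 - t))
      (hu.continuousOn.comp (by fun_prop) fun t ht => ?_) (fun t ht => ?_) ?_ (fun t ht => ?_)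
    · exact ⟨by linarith [ht.2], by linarith [ht.1]⟩
    · have h1 := hu.hasDerivAt (t := 1 - t) ⟨by linarith [ht.2], by linarith [ht.1]⟩
      have h2 : HasDerivAt (fun s : ℝ => 1 - s) (-1) t := by
        simpa using (hasDerivAt_id t).const_sub 1
      have h3 := h1.scomp t h2
      simp only [neg_smul, one_smul] at h3
      exact h3.hasDerivWithinAt
    · simpa [show (1 : ℝ) - 2⁻¹ = 2⁻¹ by norm_num] using hhalf
    · rw [norm_neg]
      exact hbound _ ⟨by linarith [ht.2], by linarith [ht.1]⟩
  intro t ht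
  rcases le_total (1 / 2) t with h1 | h1
  · exact hfwd t ⟨h1, ht.2⟩
  · have := hbwd (1 - t) ⟨by linarith, by linarith [ht.1]⟩
    simpa using this

end HeatEquation

/-! ### From weighted energies to ladders -/

section Slices

variable {n : ℕ} {h : ℝ} {V : (Fin (n + 1) → ℤ) → ℝ → ℝ} {u : ℝ → LatticeL2 (n + 1)}

/-- The rescaled slices of a solution form a ladder. -/
theorem IsHeatSolution.isLadder (hu : IsHeatSolution h V u) (hh : 0 < h)
    (hV : potentialNorm V < ⊤) (s : ℤ) :
    IsLadder (‖latticeLaplacian n h‖ + 2 / h ^ 2 + (potentialNorm V).toReal) ((1 / h ^ 2) ^ 2)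
      (fun k t => (h ^ 2) ^ k • latticeSlice n (s + k) (u t))
      (fun k t => (h ^ 2) ^ k • latticeSlice n (s + k) (deriv u t)) where
  continuousOn k := ((latticeSlice n (s + k)).continuous.comp_continuousOn
    hu.continuousOn).fun_const_smul _
  hasDerivAt k t ht :=
    ((latticeSlice n (s + k)).hasFDerivAt.comp_hasDerivAt t (hu.hasDerivAt ht)).fun_const_smul _
  residual_le k t ht := by
    set A := (potentialNorm V).toReal
    set i : ℤ := s + (k + 1 : ℕ) with hi
    set R := latticeSlice n i (deriv u t - latticeLaplacian (n + 1) h (u t)) with hR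
    have hRle : ‖R‖ ≤ A * ‖latticeSlice n i (u t)‖ := by
      refine lp_two_norm_le_mul ENNReal.toReal_nonneg fun j => ?_
      rw [hR, latticeSlice_apply, latticeSlice_apply, hu.deriv_apply ht, abs_mul]
      gcongr
      exact abs_le_of_potentialNorm_lt_top hV _ (Set.Ioo_subset_Icc_self ht)
    have hderiv : latticeSlice n i (deriv u t) = R
        + ((1 / h ^ 2) • latticeSlice n (i - 1) (u t) + (1 / h ^ 2) • latticeSlice n (i + 1) (u t)
          + (latticeLaplacian n h (latticeSlice n i (u t))
            - (2 / h ^ 2) • latticeSlice n i (u t))) := by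
      rw [hR, map_sub, ← latticeSlice_laplacian, sub_add_cancel]
    have e1 : s + (k : ℤ) = i - 1 := by rw [hi]; push_cast; ring
    have e2 : s + ((k + 2 : ℕ) : ℤ) = i + 1 := by rw [hi]; push_cast; ring
    have hE : (h ^ 2) ^ (k + 1) • latticeSlice n i (deriv u t)
        - (h ^ 2) ^ k • latticeSlice n (s + k) (u t)
        - (1 / h ^ 2) ^ 2 • (h ^ 2) ^ (k + 2) • latticeSlice n (s + (k + 2 : ℕ)) (u t)
        = (h ^ 2) ^ (k + 1) • (R + latticeLaplacian n h (latticeSlice n i (u t))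
          - (2 / h ^ 2) • latticeSlice n i (u t)) := by
      -- The scaling h^{2k} normalises the coupling to the lower slice to 1 and turns the upper one
      -- into h⁻⁴.
      have c1 : (h ^ 2) ^ (k + 1) * (1 / h ^ 2) = (h ^ 2) ^ k := by
        rw [pow_succ]; field_simp
      have c2 : (1 / h ^ 2) ^ 2 * (h ^ 2) ^ (k + 2) = (h ^ 2) ^ (k + 1) * (1 / h ^ 2) := by
        rw [c1, pow_add]; field_simp
      rw [hderiv, e1, e2, smul_smul ((1 / h ^ 2) ^ 2), c2, ← c1]
      simp only [smul_add, smul_sub, smul_smul]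
      abel
    rw [hE, norm_smul, norm_smul, mul_left_comm]
    gcongr
    have h1 := (latticeLaplacian n h).le_opNorm (latticeSlice n i (u t))
    have h2 : ‖(2 / h ^ 2) • latticeSlice n i (u t)‖ = 2 / h ^ 2 * ‖latticeSlice n i (u t)‖ := by
      rw [norm_smul, Real.norm_of_nonneg (by positivity)]
    have h3 := norm_sub_le (R + latticeLaplacian n h (latticeSlice n i (u t)))
      ((2 / h ^ 2) • latticeSlice n i (u t))
    have h4 := norm_add_le R (latticeLaplacian n h (latticeSlice n i (u t)))
    linarith

/-- Moving the origin of the chain costs a binomial coefficient, at most 2^k up to a constant;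
halving the rate pays for it. -/
theorem exists_shifted_decay {a : ℤ → ℝ} {X M C : ℝ} (hX : 0 < X) (ha : ∀ i, 0 ≤ a i)
    (haM : ∀ i, a i ≤ M) (hdec : ∀ k : ℕ, k.factorial * (2 * X) ^ k * a k ≤ C) (s : ℤ) :
    ∃ C', ∀ k : ℕ, k.factorial * X ^ k * a (s + k) ≤ C' := by
  have hM : 0 ≤ M := (ha 0).trans (haM 0)
  have hC : 0 ≤ C := le_trans (mul_nonneg (by positivity) (ha _)) (hdec 0)
  rcases Int.eq_nat_or_neg s with ⟨r, rfl | rfl⟩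
  · refine ⟨(X ^ r)⁻¹ * C, fun k => ?_⟩
    have h1 := hdec (r + k)
    push_cast at h1
    have h2 : (k.factorial : ℝ) ≤ (r + k).factorial := by
      exact_mod_cast Nat.factorial_le (by omega)
    have h3 : X ^ (r + k) ≤ (2 * X) ^ (r + k) := by gcongr; linarith
    have hak := ha (r + k)
    calc (k.factorial : ℝ) * X ^ k * a (r + k)
        = (X ^ r)⁻¹ * (k.factorial * X ^ (r + k) * a (r + k)) := by
          rw [pow_add]; field_simp
      _ ≤ (X ^ r)⁻¹ * ((r + k).factorial * (2 * X) ^ (r + k) * a (r + k)) := by gcongr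
      _ ≤ _ := by gcongr
  · refine ⟨r.factorial * (1 + X) ^ r * M + r.factorial * (2 * X) ^ r * C, fun k => ?_⟩
    have hak := ha (-(r : ℤ) + k)
    rcases lt_or_ge k r with hk | hk
    · have h1 : (k.factorial : ℝ) ≤ r.factorial := by exact_mod_cast Nat.factorial_le hk.le
      have h2 : X ^ k ≤ (1 + X) ^ r :=
        (pow_le_pow_left₀ hX.le (by linarith) k).trans (pow_le_pow_right₀ (by linarith) hk.le)
      have h3 : (k.factorial : ℝ) * X ^ k * a (-(r : ℤ) + k) ≤ r.factorial * (1 + X) ^ r * M := by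
        gcongr; exact haM _
      have h4 : 0 ≤ r.factorial * (2 * X) ^ r * C := by positivity
      linarith
    · obtain ⟨l, rfl⟩ := Nat.exists_eq_add_of_le hk
      have e : -(r : ℤ) + ((r + l : ℕ) : ℤ) = (l : ℕ) := by push_cast; ring
      rw [e] at hak ⊢
      have hchoose : ((r + l).factorial : ℝ) ≤ 2 ^ (r + l) * (r.factorial * l.factorial) := by
        have h1 := Nat.choose_mul_factorial_mul_factorial (Nat.le_add_right r l)
        rw [Nat.add_sub_cancel_left] at h1
        rw [← h1]
        have h2 : ((r + l).choose r : ℝ) ≤ 2 ^ (r + l) := by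
          exact_mod_cast Nat.choose_le_two_pow (r + l) r
        push_cast
        rw [mul_assoc]
        gcongr
      have h3 : 0 ≤ r.factorial * (1 + X) ^ r * M := by positivity
      calc ((r + l).factorial : ℝ) * X ^ (r + l) * a l
          ≤ 2 ^ (r + l) * (r.factorial * l.factorial) * X ^ (r + l) * a l := by gcongr
        _ = r.factorial * (2 * X) ^ r * (l.factorial * (2 * X) ^ l * a l) := by
            rw [mul_pow, mul_pow, pow_add, pow_add]; ring
        _ ≤ r.factorial * (2 * X) ^ r * C := by gcongr; exact hdec l
        _ ≤ _ := by linarith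

/-- A weighted energy controls the norms of the slices at both times. -/
theorem exists_slice_bound {W : (Fin (n + 1) → ℤ) → ℝ} {g : ℤ → ℝ} (hh : 0 < h)
    (hg : ∀ i, 0 ≤ g i) (hgW : ∀ i (j : Fin n → ℤ), g i ≤ W (Fin.cons i j))
    (hE : twoTimeEnergy h W u < ⊤) :
    ∃ E : ℝ, ∀ i, g i * ‖latticeSlice n i (u 0)‖ ^ 2 ≤ E ∧
      g i * ‖latticeSlice n i (u 1)‖ ^ 2 ≤ E := by
  have hS : ∑' j, ENNReal.ofReal (W j * (|u 0 j| ^ 2 + |u 1 j| ^ 2)) ≠ ⊤ := by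
    intro htop
    rw [twoTimeEnergy, htop, ENNReal.mul_top] at hE
    · exact hE.ne rfl
    · exact (ENNReal.ofReal_pos.2 (by positivity)).ne'
  set S := ∑' j, ENNReal.ofReal (W j * (|u 0 j| ^ 2 + |u 1 j| ^ 2))
  have key : ∀ i (f : LatticeL2 (n + 1)), (∀ j, f j ^ 2 ≤ |u 0 j| ^ 2 + |u 1 j| ^ 2) →
      g i * ‖latticeSlice n i f‖ ^ 2 ≤ S.toReal := by
    intro i f hf
    refine (ENNReal.ofReal_le_iff_le_toReal hS).1 ?_
    rw [lp_two_norm_sq, ← tsum_mul_left, ENNReal.ofReal_tsum_of_nonneg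
      (fun j => mul_nonneg (hg i) (sq_nonneg _)) ((lp_two_summable_sq _).mul_left _)]
    calc ∑' j : Fin n → ℤ, ENNReal.ofReal (g i * latticeSlice n i f j ^ 2)
        ≤ ∑' j : Fin n → ℤ, ENNReal.ofReal (W (Fin.cons i j) *
          (|u 0 (Fin.cons i j)| ^ 2 + |u 1 (Fin.cons i j)| ^ 2)) := by
          refine ENNReal.tsum_le_tsum fun j => ENNReal.ofReal_le_ofReal ?_
          exact mul_le_mul (hgW i j) (hf _) (sq_nonneg _) ((hg i).trans (hgW i j))
      _ ≤ S := ENNReal.tsum_comp_le_tsum_of_injective (Fin.cons_right_injective (α := fun _ => ℤ) i)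
          fun j => ENNReal.ofReal (W j * (|u 0 j| ^ 2 + |u 1 j| ^ 2))
  refine ⟨S.toReal, fun i => ⟨key i (u 0) fun j => ?_, key i (u 1) fun j => ?_⟩⟩ <;>
  · rw [sq_abs, sq_abs]
    nlinarith [sq_nonneg (u 0 j), sq_nonneg (u 1 j)]

/-- Uniqueness for solutions whose slices decay factorially at times `0` and `1`. -/
theorem IsHeatSolution.eq_zero_of_energy (hu : IsHeatSolution h V u) (hh : 0 < h)
    (hV : potentialNorm V < ⊤) {W : (Fin (n + 1) → ℤ) → ℝ} {g : ℤ → ℝ} {c : ℝ}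
    (hg : ∀ i, 0 ≤ g i) (hgW : ∀ i (j : Fin n → ℤ), g i ≤ W (Fin.cons i j))
    (hgc : ∀ k : ℕ, (k.factorial * (512 * h ^ 2) ^ k) ^ 2 ≤ c * g k)
    (hE : twoTimeEnergy h W u < ⊤) : ∀ t ∈ Set.Icc (0 : ℝ) 1, u t = 0 := by
  obtain ⟨E, hEb⟩ := exists_slice_bound hh hg hgW hE
  obtain ⟨M, hM⟩ := isCompact_Icc.exists_bound_of_continuousOn hu.continuousOn
  have hslice : ∀ i, ∀ t ∈ Set.Icc (0 : ℝ) 1, ‖latticeSlice n i (u t)‖ ≤ M := fun i t ht =>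
    (norm_lpRestrict_apply_le _ _ _).trans (hM t ht)
  have hc : 0 ≤ c := by
    have h1 := hgc 0
    have h2 := hg 0
    simp only [Nat.factorial_zero, Nat.cast_one, pow_zero, mul_one, one_pow, Nat.cast_zero] at h1
    by_contra hneg
    push Not at hneg
    nlinarith
  have hend : ∀ f : LatticeL2 (n + 1), (∀ i, g i * ‖latticeSlice n i f‖ ^ 2 ≤ E) → ∀ k : ℕ,
      k.factorial * (2 * (256 * h ^ 2)) ^ k * ‖latticeSlice n k f‖ ≤ √(c * E) := by
    intro f hf k
    refine Real.le_sqrt_of_sq_le ?_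
    have h1 := mul_le_mul_of_nonneg_right (hgc k) (sq_nonneg ‖latticeSlice n k f‖)
    have h2 := mul_le_mul_of_nonneg_left (hf k) hc
    -- The rate 512h² is halved by the shift of origin, and the scaling h^{2k} reduces 256h² to the
    -- 2 · 128 required of a ladder.
    rw [mul_pow, show 2 * (256 * h ^ 2) = 512 * h ^ 2 by ring]
    linarith
  refine hu.eq_zero_of_half hV ?_
  -- The ladder argument kills site 1 only, so the chain is started at i − 1 for every i.
  have hzero : ∀ i : ℤ, latticeSlice n i (u (1 / 2)) = 0 := by
    intro i
    have hdec : ∀ t ∈ Set.Icc (0 : ℝ) 1, (∀ i, g i * ‖latticeSlice n i (u t)‖ ^ 2 ≤ E) →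
        ∃ C', ∀ k : ℕ, k.factorial * (256 * h ^ 2) ^ k * ‖latticeSlice n (i - 1 + k) (u t)‖ ≤ C' :=
      fun t ht hf => exists_shifted_decay (a := fun i => ‖latticeSlice n i (u t)‖) (by positivity)
        (fun i => norm_nonneg _) (fun i => hslice i t ht) (hend _ hf) (i - 1)
    obtain ⟨C₀, hC₀⟩ := hdec 0 (by simp) fun i => (hEb i).1
    obtain ⟨C₁, hC₁⟩ := hdec 1 (by simp) fun i => (hEb i).2
    have hnorm : ∀ (k : ℕ) (t : ℝ), ‖(h ^ 2) ^ k • latticeSlice n (i - 1 + k) (u t)‖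
        = (h ^ 2) ^ k * ‖latticeSlice n (i - 1 + k) (u t)‖ := fun k t => by
      rw [norm_smul, Real.norm_of_nonneg (by positivity)]
    have hv := (hu.isLadder hh hV (i - 1)).eq_zero_at_half (T := 1 / h ^ 2) (C := max C₀ C₁)
      (M₀ := M) (by positivity) (fun k t ht => ?_) (fun k => ?_) (fun k => ?_)
    · rw [smul_eq_zero] at hv
      rcases hv with hv | hv
      · exact absurd hv (by positivity)
      · simpa using hv
    · rw [hnorm, one_div, inv_pow, div_inv_eq_mul, mul_comm]
      gcongr
      exact hslice _ t ht
    · rw [hnorm]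
      refine le_trans (le_of_eq ?_) ((hC₀ k).trans (le_max_left _ _))
      rw [mul_pow 256]; norm_num; ring
    · rw [hnorm]
      refine le_trans (le_of_eq ?_) ((hC₁ k).trans (le_max_right _ _))
      rw [mul_pow 256]; norm_num; ring
  ext j
  have hj := congrArg (fun f : LatticeL2 n => f (Fin.tail j)) (hzero (j 0))
  simpa [latticeSlice_apply, Fin.cons_self_tail] using hj

end Slices

/-! ### The two uniqueness statements -/

theorem one_le_prod_of_one_le {ι : Type*} (s : Finset ι) {f : ι → ℝ} (hf : ∀ i, 1 ≤ f i) :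
    1 ≤ ∏ i ∈ s, f i := by
  simpa using Finset.prod_le_prod (s := s) (fun _ _ => zero_le_one) fun i _ => hf i

/-- Uniqueness for the discrete heat equation with bounded potential under Macdonald weights. -/
theorem theorem1p1 (d : ℕ) (hd : 1 ≤ d) :
    (∃ C : ℝ, 0 < C ∧ ∀ γ : ℝ, 0 < γ → γ < C → ∀ A B c : ℝ≥0, ∃ h₀ : ℝ, 0 < h₀ ∧
      ∀ h : ℝ, 0 < h → h < h₀ → ∀ (V : (Fin d → ℤ) → ℝ → ℝ) (u : ℝ → LatticeL2 d),
        IsHeatSolution h V u → potentialNorm V ≤ A → spaceTimeNorm h u ≤ B →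
        twoTimeEnergy h (continuumWeight γ h) u ≤ c →
        ∀ t ∈ Set.Icc (0 : ℝ) 1, u t = 0) ∧
    (∃ μ₀ : ℝ, 0 < μ₀ ∧ ∀ μ : ℝ, μ₀ < μ → ∀ h : ℝ, 0 < h →
      ∀ (V : (Fin d → ℤ) → ℝ → ℝ) (u : ℝ → LatticeL2 d),
        IsHeatSolution h V u → potentialNorm V < ⊤ → spaceTimeNorm h u < ⊤ →
        twoTimeEnergy h (discreteWeight μ h) u < ⊤ →
        ∀ t ∈ Set.Icc (0 : ℝ) 1, u t = 0) := by
  obtain ⟨n, rfl⟩ : ∃ n, d = n + 1 := ⟨d - 1, by omega⟩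
  -- γ < 1/(512e³) says that 1/(ze³) > 512h² for z = γ/h². No smallness of h is needed, so h₀ = 1 is
  -- arbitrary.
  refine ⟨⟨1 / (512 * Real.exp 3), by positivity, fun γ hγ hγC A B c => ⟨1, one_pos, ?_⟩⟩,
    ⟨4, by norm_num, ?_⟩⟩
  · intro h hh _ V u hu hV _ hE
    have hz : 0 < γ / h ^ 2 := by positivity
    set z := γ / h ^ 2 with hzdef
    have hK0 := macdonaldK_pos 0 hz
    refine hu.eq_zero_of_energy hh (hV.trans_lt ENNReal.coe_lt_top)
      (W := continuumWeight γ h) (g := fun i => macdonaldK i z ^ 2 / macdonaldK 0 z ^ 2)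
      (c := (macdonaldK 0 z / (1 / 2 * Real.exp (-(3 * z)))) ^ 2)
      (fun i => by positivity) (fun i j => ?_) (fun k => ?_) (hE.trans_lt ENNReal.coe_lt_top)
    · rw [continuumWeight, Fin.prod_univ_succ, Fin.cons_zero]
      refine le_mul_of_one_le_right (by positivity) ?_
      refine one_le_prod_of_one_le _ fun k => ?_
      rw [← div_pow]
      exact one_le_pow₀ (one_le_macdonaldK_div _ hz)
    · have h1 := macdonaldK_natCast_ge k hz
      have h2 : (k.factorial : ℝ) * (512 * h ^ 2) ^ k ≤ k.factorial / (z * Real.exp 3) ^ k := by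
        rw [div_eq_mul_inv, ← inv_pow]
        gcongr
        rw [lt_div_iff₀ (by positivity)] at hγC
        rw [le_inv_comm₀ (by positivity) (by positivity), hzdef, le_inv_comm₀ (by positivity)
          (by positivity), inv_eq_one_div, le_div_iff₀ (by positivity)]
        calc 512 * h ^ 2 * (γ / h ^ 2 * Real.exp 3) = γ * (512 * Real.exp 3) := by field_simp
          _ ≤ 1 := hγC.le
      have he : 0 < 1 / 2 * Real.exp (-(3 * z)) := by positivity
      have h3 : (k.factorial : ℝ) * (512 * h ^ 2) ^ k ≤
          macdonaldK k z / (1 / 2 * Real.exp (-(3 * z))) := by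
        refine h2.trans ?_
        rw [le_div_iff₀ he, mul_comm]; exact h1
      calc _ ≤ (macdonaldK k z / (1 / 2 * Real.exp (-(3 * z)))) ^ 2 := by gcongr
        _ = _ := by
          rw [Int.cast_natCast]
          field_simp
  · intro μ hμ h hh V u hu hV _ hE
    have hz : 0 < 2 / (Real.exp 1 * h ^ 2) := by positivity
    set z := 2 / (Real.exp 1 * h ^ 2) with hzdef
    have hK0 := macdonaldK_pos 0 hz
    set y := z * Real.exp 3
    have hy : 0 < y := by positivity
    -- Order 4k suffices: (4k)! ≥ (k!)⁴, where two factorials match the squared requirement and the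
    -- other two absorb R^{2k} through R^k ≤ e^R k!. This works for every h.
    set R := 512 * h ^ 2 * y ^ 2
    refine hu.eq_zero_of_energy hh hV
      (W := discreteWeight μ h) (g := fun i => macdonaldK ((i : ℝ) * μ) z / macdonaldK 0 z)
      (c := macdonaldK 0 z / (1 / 2 * Real.exp (-(3 * z))) * Real.exp R ^ 2)
      (fun i => (zero_le_one.trans (one_le_macdonaldK_div _ hz))) (fun i j => ?_)
      (fun k => ?_) hE
    · rw [discreteWeight, Fin.prod_univ_succ, Fin.cons_zero]
      refine le_mul_of_one_le_right (zero_le_one.trans (one_le_macdonaldK_div _ hz)) ?_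
      exact one_le_prod_of_one_le _ fun k => one_le_macdonaldK_div _ hz
    · have h1 := macdonaldK_natCast_ge (4 * k) hz
      have h2 : macdonaldK ((4 * k : ℕ) : ℝ) z ≤ macdonaldK ((k : ℝ) * μ) z := by
        refine macdonaldK_le_of_abs_le hz ?_
        rw [abs_of_nonneg (by positivity), abs_of_nonneg (by positivity)]
        push_cast
        nlinarith [k.cast_nonneg (α := ℝ)]
      have h3 : (k.factorial : ℝ) ^ 4 ≤ (4 * k).factorial := by
        have hmul : ∀ a b : ℕ, a.factorial * b.factorial ≤ (a + b).factorial := fun a b =>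
          Nat.le_of_dvd (Nat.factorial_pos _) (Nat.factorial_mul_factorial_dvd_factorial_add a b)
        have h2k : k.factorial ^ 4 ≤ (k + k + (k + k)).factorial := by
          refine le_trans ?_ (hmul (k + k) (k + k))
          calc k.factorial ^ 4 = (k.factorial * k.factorial) * (k.factorial * k.factorial) := by ring
            _ ≤ _ := Nat.mul_le_mul (hmul k k) (hmul k k)
        rw [show 4 * k = k + k + (k + k) by ring]
        exact_mod_cast h2k
      have h4 : R ^ k ≤ Real.exp R * k.factorial := by
        have := Real.pow_div_factorial_le_exp R (by positivity) k
        rwa [div_le_iff₀ (by positivity)] at this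
      have he : 0 < 1 / 2 * Real.exp (-(3 * z)) := by positivity
      have h5 : ((4 * k).factorial : ℝ) / y ^ (4 * k) ≤
          macdonaldK ((k : ℝ) * μ) z / (1 / 2 * Real.exp (-(3 * z))) := by
        rw [le_div_iff₀ he, mul_comm]; exact h1.trans h2
      calc ((k.factorial : ℝ) * (512 * h ^ 2) ^ k) ^ 2
          = k.factorial ^ 2 * (R ^ k) ^ 2 / y ^ (4 * k) := by
            simp only [R]
            rw [mul_pow _ (y ^ 2) k, eq_div_iff (by positivity)]
            ring_nf
        _ ≤ k.factorial ^ 2 * (Real.exp R * k.factorial) ^ 2 / y ^ (4 * k) := by gcongr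
        _ = Real.exp R ^ 2 * (k.factorial ^ 4 / y ^ (4 * k)) := by ring
        _ ≤ Real.exp R ^ 2 * ((4 * k).factorial / y ^ (4 * k)) := by gcongr
        _ ≤ Real.exp R ^ 2 * (macdonaldK ((k : ℝ) * μ) z / (1 / 2 * Real.exp (-(3 * z)))) := by
            gcongr
        _ = _ := by
            rw [Int.cast_natCast]
            field_simp

end
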